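/- For a composition $\mathbf k=(k_1,\dots,k_r)$ of positive integers (possibly empty, $r=0$) put $|\mathbf k|=k_1+\cdots+k_r$, and for $n\ge 0$ let $$\zeta_n(\mathbf k)=\sum_{n\ge n_1>\cdots>n_r>0}\prod_{j=1}^r\frac1{n_j^{k_j}},\quad t_n(\mathbf k)=\sum_{n\ge n_1>\cdots>n_r>0}\prod_{j=1}^r\frac1{(2n_j-1)^{k_j}},\quad t^\star_n(\mathbf k)=\sum_{n\ge n_1\ge\cdots\ge n_r>0}\prod_{j=1}^r\frac1{(2n_j-1)^{k_j}},$$ all equal to $1$ for $\mathbf k=\emptyset$ (and to $0$ when the range of summation is empty and $r\ge1$). Let $2_{d}$ denote $(2,\dots,2)$ with $d$ entries. Let $\mathrm{CMZV}^4_w\subset\mathbb C$ be the $\mathbb Q$-linear span of the colored multiple zeta values of level $4$ and weight $w$, i.e. of the numbers $$\mathrm{Li}_{s_1,\dots,s_d}(z_1,\dots,z_d)=\sum_{n_1>\cdots>n_d>0}\frac{z_1^{n_1}\cdots z_d^{n_d}}{n_1^{s_1}\cdots n_d^{s_d}}=\lim_{n\to\infty}\ \sum_{n\ge n_1>\cdots>n_d>0}\frac{z_1^{n_1}\cdots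 z_d^{n_d}}{n_1^{s_1}\cdots n_d^{s_d}}$$ with positive integers $s_j$, $s_1+\cdots+s_d=w$, $z_j^4=1$ and $(s_1,z_1)\ne(1,1)$. Theorem. Let $m,p\ge1$ be integers and let $\mathbf k$ be a composition, possibly empty. Then both of the following series converge and $$\sum_{n=0}^\infty \frac{\binom{2n}{n}}{4^n}\,\frac{t_n(2_{p-1})\,t^\star_n(\mathbf k)}{(2n+1)^m}\in i\,\mathrm{CMZV}^4_{2p+m+|\mathbf k|-2},\qquad \sum_{n=1}^\infty \frac{4^n\,\zeta_{n-1}(2_{p-1})\,t^\star_n(\mathbf k)}{\binom{2n}{n}\,n^{m+1}}\in \mathrm{CMZV}^4_{2p+m+|\mathbf k|-1}.$$ (The $n=0$ term of the first series is $1$ if $p=1$ and $\mathbf k=\emptyset$, and $0$ in all other cases, so that in all other cases the first sum may equally be started at $n=1$.) -/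

import Mathlib

open Filter Topology

noncomputable section

/-- The multiple harmonic sum `ζ_n(k₁,…,k_r) = ∑_{n ≥ n₁ > ⋯ > n_r > 0} ∏ 1 / n_j ^ k_j`,
summed over `n₁ = j + 1` first, so that `n₂ ≤ j`. It is `1` for the empty composition. -/
def multHarmonic : List ℕ → ℕ → ℝ
  | [], _ => 1
  | k :: ks, n => ∑ j ∈ Finset.range n, 1 / ((j : ℝ) + 1) ^ k * multHarmonic ks j

/-- The multiple `t`-harmonic sum
`t_n(k₁,…,k_r) = ∑_{n ≥ n₁ > ⋯ > n_r > 0} ∏ 1 / (2 n_j - 1) ^ k_j`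
(with `n₁ = j + 1`, so that `2 n₁ - 1 = 2 j + 1` and `n₂ ≤ j`). -/
def multTHarmonic : List ℕ → ℕ → ℝ
  | [], _ => 1
  | k :: ks, n => ∑ j ∈ Finset.range n, 1 / (2 * (j : ℝ) + 1) ^ k * multTHarmonic ks j

/-- The multiple `t`-harmonic star sum
`t⋆_n(k₁,…,k_r) = ∑_{n ≥ n₁ ≥ ⋯ ≥ n_r > 0} ∏ 1 / (2 n_j - 1) ^ k_j`
(with `n₁ = j + 1`, so that `2 n₁ - 1 = 2 j + 1` and `n₂ ≤ j + 1`). -/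
def multTHarmonicStar : List ℕ → ℕ → ℝ
  | [], _ => 1
  | k :: ks, n =>
      ∑ j ∈ Finset.range n, 1 / (2 * (j : ℝ) + 1) ^ k * multTHarmonicStar ks (j + 1)

/-- For a list of pairs `(k₁,z₁),…,(k_r,z_r)`, the partial sum
`∑_{n ≥ n₁ > ⋯ > n_r > 0} ∏ z_j ^ n_j / n_j ^ k_j` of `Li_{k₁,…,k_r}(z₁,…,z_r)`. -/
def coloredSum : List (ℕ × ℂ) → ℕ → ℂ
  | [], _ => 1
  | (k, z) :: l, n =>
      ∑ j ∈ Finset.range n, z ^ (j + 1) / ((j : ℂ) + 1) ^ k * coloredSum l j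

/-- `x` is a colored multiple zeta value of level `N` and weight `w`:
`x = Li_{k₁,…,k_r}(z₁,…,z_r)` with positive integers `k_j` of sum `w`, `N`-th roots of unity `z_j`
and `(k₁,z₁) ≠ (1,1)`, the series being the limit of its partial sums over `n₁ ≤ n`. -/
def IsColoredMZV (N w : ℕ) (x : ℂ) : Prop :=
  ∃ l : List (ℕ × ℂ),
    (∀ a ∈ l, 0 < a.1 ∧ a.2 ^ N = 1) ∧
    l.head? ≠ some (1, 1) ∧
    (l.map Prod.fst).sum = w ∧
    Tendsto (coloredSum l) atTop (𝓝 x)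

/-- The `ℚ`-linear span in `ℂ` of the colored multiple zeta values of level `N` and weight `w`. -/
def CMZV (N w : ℕ) : Submodule ℚ ℂ :=
  Submodule.span ℚ {x : ℂ | IsColoredMZV N w x}

end

/-!
Both series are values at `x = 1` of power series in `x`. With `x = sin θ` and
`x = 2 t / (1 + t ^ 2)`, the differential forms `dx / x`, `dx / (1 - x ^ 2)`,
`x dx / (1 - x ^ 2)` and `i dθ` become integral combinations of `dt / t` and
`a dt / (1 - a t)` with `a ^ 4 = 1`. The theorem follows once the power series are built up from
constants by integrating against these forms: the result is an iterated integral of level four, and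
its value at `t = 1` is a colored multiple zeta value.

* *The starting functions.* The generating functions of `binom(2n, n) / 4 ^ n * t_n(2, …, 2)` and
  of `4 ^ n * ζ_{n-1}(2, …, 2) / (binom(2n, n) * n ^ 2)`, the former after division of the
  coefficients by `2 n + 1`, are rational multiples of powers of `θ`, because applying
  `(d / dθ) ^ 2` removes one entry `2` (`inIterSpan_odd`, `inIterSpan_even`). Further powers of
  the summation index in the denominator are integrations against `dx / x`. The odd powers of `i dθ`
  in the first case account for the factor `i`.
* *The star sums.* Interchanging the summations turns `∑ eₙ t⋆ₙ(k₁, k₂, …)` into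
  `∑ Tⱼ / (2 j - 1) ^ k₁ * t⋆ⱼ(k₂, …)` with the tails `Tⱼ = ∑_{n ≥ j} eₙ`. If `g` is the generating
  function of `e`, the one of `T` is `(g(1) - g) / (1 - x ^ 2)`, up to parity. Hence an entry
  is removed by one integration against `dx / (1 - x ^ 2)` or its companions and further ones
  against `dx / x` (`IsRepresented.tail`, `IsRepresented.tsum_mul_star_mem`). The constants `g(1)`
  are again colored multiple zeta values, which form a graded algebra by the stuffle product
  (`mul_mem_CMZV`).
* *Evaluation at `1`.* The individual iterated integrals can diverge like powers of `log (1 - t)`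
  even though the function in question has a limit. Shuffle regularization
  (`HasReg.iterInt_replicate_append`) writes each one as a polynomial in `log (1 - t)` whose
  coefficients are combinations of convergent iterated integrals; these tend to colored multiple
  zeta values with a power saving (`tendsto_iterInt_sub_mul_pow`). A limit therefore sees only the
  constant term (`HasReg.limit_mem`).
-/

/-! ### Power series with polynomially bounded coefficients -/

/-- The coefficient sequence `c` grows at most polynomially. -/
def PolyBdd (c : ℕ → ℂ) : Prop :=
  ∃ C : ℝ, ∃ K : ℕ, ∀ n, ‖c n‖ ≤ C * ((n : ℝ) + 1) ^ K

/-- The sum of the power series with coefficients `c`, at a real point. -/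
noncomputable def ps (c : ℕ → ℂ) (t : ℝ) : ℂ := ∑' n, c n * (t : ℂ) ^ n

lemma PolyBdd.of_norm_le {c : ℕ → ℂ} (C : ℝ) (h : ∀ n, ‖c n‖ ≤ C) : PolyBdd c :=
  ⟨C, 0, by simpa using h⟩

lemma PolyBdd.mono {c d : ℕ → ℂ} (h : PolyBdd c) (hd : ∀ n, ‖d n‖ ≤ ‖c n‖) : PolyBdd d := by
  obtain ⟨C, K, h⟩ := h
  exact ⟨C, K, fun n => (hd n).trans (h n)⟩

lemma PolyBdd.shift {c : ℕ → ℂ} (h : PolyBdd c) : PolyBdd fun n => c (n + 1) := by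
  obtain ⟨C, K, h⟩ := h
  have hC : 0 ≤ C := by simpa using (norm_nonneg _).trans (h 0)
  refine ⟨C * 2 ^ K, K, fun n => (h (n + 1)).trans ?_⟩
  rw [mul_assoc, ← mul_pow]
  gcongr
  push_cast
  linarith [(Nat.cast_nonneg n : (0 : ℝ) ≤ n)]

lemma PolyBdd.natMul {c : ℕ → ℂ} (h : PolyBdd c) : PolyBdd fun n => (n : ℂ) * c n := by
  obtain ⟨C, K, h⟩ := h
  have hC : 0 ≤ C := by simpa using (norm_nonneg _).trans (h 0)
  refine ⟨C, K + 1, fun n => ?_⟩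
  rw [norm_mul, Complex.norm_natCast, pow_succ]
  calc (n : ℝ) * ‖c n‖ ≤ ((n : ℝ) + 1) * (C * ((n : ℝ) + 1) ^ K) := by
        gcongr
        · linarith
        · exact h n
    _ = _ := by ring

lemma PolyBdd.add {c d : ℕ → ℂ} (hc : PolyBdd c) (hd : PolyBdd d) :
    PolyBdd fun n => c n + d n := by
  obtain ⟨C, K, hc⟩ := hc
  obtain ⟨D, M, hd⟩ := hd
  have hC : 0 ≤ C := by simpa using (norm_nonneg _).trans (hc 0)
  have hD : 0 ≤ D := by simpa using (norm_nonneg _).trans (hd 0)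
  refine ⟨C + D, K + M, fun n => (norm_add_le _ _).trans ?_⟩
  have h1 : (1 : ℝ) ≤ (n : ℝ) + 1 := by linarith [(Nat.cast_nonneg n : (0 : ℝ) ≤ n)]
  rw [add_mul]
  refine add_le_add ((hc n).trans ?_) ((hd n).trans ?_)
  · gcongr
    omega
  · gcongr
    omega

lemma PolyBdd.const_mul {c : ℕ → ℂ} (z : ℂ) (h : PolyBdd c) : PolyBdd fun n => z * c n := by
  obtain ⟨C, K, h⟩ := h
  refine ⟨‖z‖ * C, K, fun n => ?_⟩
  rw [norm_mul, mul_assoc]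
  gcongr
  exact h n

lemma PolyBdd.deriv {c : ℕ → ℂ} (h : PolyBdd c) :
    PolyBdd fun n => ((n : ℂ) + 1) * c (n + 1) := by
  simpa using h.natMul.shift

lemma PolyBdd.summable {c : ℕ → ℂ} (h : PolyBdd c) {t : ℝ} (ht : |t| < 1) :
    Summable fun n => c n * (t : ℂ) ^ n := by
  obtain ⟨C, K, h⟩ := h
  have hs : Summable fun n : ℕ => C * 2 ^ K * ((n : ℝ) ^ K * |t| ^ n + 0 ^ n) := by
    refine Summable.mul_left _ (Summable.add ?_ ?_)
    · exact summable_pow_mul_geometric_of_norm_lt_one K (by simpa using ht)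
    · exact summable_geometric_of_lt_one le_rfl zero_lt_one
  have hC : 0 ≤ C := by simpa using (norm_nonneg _).trans (h 0)
  refine Summable.of_norm_bounded hs fun n => ?_
  rw [norm_mul, norm_pow, Complex.norm_real, Real.norm_eq_abs, mul_assoc]
  rcases Nat.eq_zero_or_pos n with rfl | hn
  · have h0 : ‖c 0‖ ≤ C := by simpa using h 0
    have h2 : (1 : ℝ) ≤ 2 ^ K := one_le_pow₀ one_le_two
    have h3 : (0 : ℝ) ≤ 0 ^ K := by positivity
    simp only [pow_zero, mul_one, Nat.cast_zero]
    nlinarith [mul_nonneg hC h3, mul_nonneg (mul_nonneg hC h3) (zero_le_one.trans h2)]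
  · have h1 : (1 : ℝ) ≤ n := by exact_mod_cast hn
    calc ‖c n‖ * |t| ^ n ≤ C * (2 * (n : ℝ)) ^ K * |t| ^ n := by
          gcongr
          refine (h n).trans ?_
          gcongr
          linarith
      _ = C * (2 ^ K * ((n : ℝ) ^ K * |t| ^ n + 0)) := by rw [mul_pow]; ring
      _ ≤ _ := by gcongr; positivity

lemma ps_zero (c : ℕ → ℂ) : ps c 0 = c 0 := by
  rw [ps, tsum_eq_single 0]
  · simp
  · intro n hn
    simp [hn]

lemma ps_eq_add {c : ℕ → ℂ} (h : PolyBdd c) {t : ℝ} (ht : |t| < 1) :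
    ps c t = c 0 + t * ps (fun n => c (n + 1)) t := by
  rw [ps, (h.summable ht).tsum_eq_zero_add, ps, ← tsum_mul_left]
  simp only [pow_zero, mul_one]
  congr 2
  ext n
  ring

lemma ps_add {c d : ℕ → ℂ} (hc : PolyBdd c) (hd : PolyBdd d) {t : ℝ} (ht : |t| < 1) :
    ps (fun n => c n + d n) t = ps c t + ps d t := by
  rw [ps, ps, ps, ← (hc.summable ht).tsum_add (hd.summable ht)]
  congr 1
  ext n
  ring

lemma ps_const_mul (z : ℂ) (c : ℕ → ℂ) (t : ℝ) : ps (fun n => z * c n) t = z * ps c t := by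
  rw [ps, ps, ← tsum_mul_left]
  congr 1
  ext n
  ring

lemma hasDerivAt_ps {c : ℕ → ℂ} (h : PolyBdd c) {t : ℝ} (ht : |t| < 1) :
    HasDerivAt (ps c) (ps (fun n => ((n : ℂ) + 1) * c (n + 1)) t) t := by
  obtain ⟨r, hr, hr1⟩ := exists_between ht
  have hr0 : 0 ≤ r := (abs_nonneg t).trans hr.le
  have hder : Summable fun n : ℕ => ‖((n : ℂ) + 1) * c (n + 1) * (r : ℂ) ^ n‖ :=
    (h.deriv.summable (by rwa [abs_of_nonneg hr0])).norm
  have hu : Summable fun n : ℕ => ‖(n : ℂ) * c n * (r : ℂ) ^ (n - 1)‖ := by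
    rw [← summable_nat_add_iff 1]
    simpa using hder
  have key := hasDerivAt_tsum_of_isPreconnected (g := fun n (s : ℝ) => c n * (s : ℂ) ^ n)
    (g' := fun n (s : ℝ) => c n * ((n : ℂ) * (s : ℂ) ^ (n - 1))) (t := Metric.ball (0 : ℝ) r)
    hu Metric.isOpen_ball
    (convex_ball (0 : ℝ) r).isPreconnected
    (fun n y _ => by
      have := ((hasDerivAt_id (y : ℂ)).pow n).comp_ofReal.const_mul (c n)
      simpa using this)
    (fun n y hy => by
      rw [mem_ball_zero_iff, Real.norm_eq_abs] at hy
      simp only [norm_mul, norm_pow, Complex.norm_real, Real.norm_eq_abs]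
      rw [← mul_assoc, mul_comm ‖c n‖, abs_of_nonneg hr0]
      gcongr)
    (y₀ := 0) (by simpa using (abs_nonneg t).trans_lt hr) (h.summable (by simp))
    (y := t) (by simpa using hr)
  suffices h : ps (fun n => ((n : ℂ) + 1) * c (n + 1)) t
      = ∑' n, c n * ((n : ℂ) * (t : ℂ) ^ (n - 1)) by
    rw [h]
    exact key
  have hs : Summable fun n => c n * ((n : ℂ) * (t : ℂ) ^ (n - 1)) := by
    rw [← summable_nat_add_iff 1]
    refine (h.deriv.summable ht).congr fun n => ?_
    push_cast
    ring
  rw [ps, hs.tsum_eq_zero_add]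
  simp only [Nat.cast_zero, zero_mul, mul_zero, zero_add, Nat.cast_add, Nat.cast_one,
    Nat.add_sub_cancel]
  congr 1
  ext n
  ring

lemma tendsto_ps_zero {c : ℕ → ℂ} (h : PolyBdd c) : Tendsto (ps c) (𝓝[>] 0) (𝓝 (c 0)) := by
  have := (hasDerivAt_ps h (t := 0) (by simp)).continuousAt.tendsto
  rw [ps_zero] at this
  exact this.mono_left nhdsWithin_le_nhds

lemma abs_lt_one_of_mem {t : ℝ} (ht : t ∈ Set.Ioo (0 : ℝ) 1) : |t| < 1 := by
  rw [abs_of_pos ht.1]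
  exact ht.2

/-- Two primitives of the same function on `(0,1)` with the same limit at `0` coincide. -/
lemma eqOn_of_hasDerivAt {F G : ℝ → ℂ} {h : ℝ → ℂ} {l : ℂ}
    (hF : ∀ t ∈ Set.Ioo (0 : ℝ) 1, HasDerivAt F (h t) t)
    (hG : ∀ t ∈ Set.Ioo (0 : ℝ) 1, HasDerivAt G (h t) t)
    (hF0 : Tendsto F (𝓝[>] 0) (𝓝 l)) (hG0 : Tendsto G (𝓝[>] 0) (𝓝 l)) :
    ∀ t ∈ Set.Ioo (0 : ℝ) 1, F t = G t := by
  intro t ht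
  have hd : ∀ s ∈ Set.Ioo (0 : ℝ) 1, HasDerivAt (fun x => F x - G x) 0 s := fun s hs => by
    rw [← sub_self (h s)]
    exact (hF s hs).sub (hG s hs)
  have hc : ∀ s ∈ Set.Ioo (0 : ℝ) 1, F s - G s = F t - G t := fun s hs =>
    isOpen_Ioo.is_const_of_deriv_eq_zero isPreconnected_Ioo
      (fun s hs => (hd s hs).differentiableAt.differentiableWithinAt)
      (fun s hs => (hd s hs).deriv) hs ht
  have h0 : Tendsto (fun x => F x - G x) (𝓝[>] 0) (𝓝 (F t - G t)) := by
    refine tendsto_const_nhds.congr' ?_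
    filter_upwards [Ioo_mem_nhdsGT (zero_lt_one (α := ℝ))] with s hs
    exact (hc s hs).symm
  have := tendsto_nhds_unique h0 (hF0.sub hG0)
  rw [sub_self] at this
  exact sub_eq_zero.mp this

/-! ### The central binomial coefficients -/

/-- The normalized central binomial coefficient `binom(2n, n) / 4 ^ n`. -/
noncomputable def cbin (n : ℕ) : ℝ := (Nat.centralBinom n : ℝ) / 4 ^ n

lemma cbin_zero : cbin 0 = 1 := by simp [cbin]

lemma cbin_pos (n : ℕ) : 0 < cbin n := by
  have := Nat.centralBinom_pos n
  unfold cbin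
  positivity

lemma cbin_succ (n : ℕ) : 2 * ((n : ℝ) + 1) * cbin (n + 1) = (2 * n + 1) * cbin n := by
  have h : ((n : ℝ) + 1) * (Nat.centralBinom (n + 1) : ℝ)
      = 2 * (2 * n + 1) * Nat.centralBinom n := by
    exact_mod_cast Nat.succ_mul_centralBinom_succ n
  unfold cbin
  rw [pow_succ]
  field_simp
  linarith

lemma cbin_succ_eq (n : ℕ) : cbin (n + 1) = (2 * n + 1) / (2 * ((n : ℝ) + 1)) * cbin n := by
  have := cbin_succ n
  field_simp
  linarith

lemma cbin_sub (n : ℕ) : cbin n - cbin (n + 1) = cbin (n + 1) / (2 * n + 1) := by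
  have := cbin_succ n
  have h : (0 : ℝ) < 2 * n + 1 := by positivity
  field_simp
  linarith

lemma sum_cbin (n : ℕ) : ∑ j ∈ Finset.range n, cbin j = 2 * n * cbin n := by
  induction n with
  | zero => simp
  | succ n ih =>
    rw [Finset.sum_range_succ, ih]
    push_cast
    linarith [cbin_succ n]

lemma cbin_sq_le (n : ℕ) : cbin n ^ 2 * (2 * n + 1) ≤ 1 := by
  induction n with
  | zero => simp [cbin_zero]
  | succ n ih =>
    refine le_trans ?_ ih
    rw [cbin_succ_eq, mul_pow, div_pow]
    push_cast
    have h := sq_nonneg (cbin n)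
    rw [div_mul_eq_mul_div, div_mul_eq_mul_div, div_le_iff₀ (by positivity)]
    have : (2 * (n : ℝ) + 1) * (2 * (n + 1) + 1) ≤ (2 * (n + 1)) ^ 2 := by ring_nf; linarith
    calc _ = cbin n ^ 2 * (2 * n + 1) * ((2 * (n : ℝ) + 1) * (2 * (n + 1) + 1)) := by ring
      _ ≤ _ := by gcongr

lemma le_cbin_sq (n : ℕ) : 1 ≤ cbin (n + 1) ^ 2 * (4 * (n + 1)) := by
  induction n with
  | zero => rw [cbin_succ_eq, cbin_zero]; norm_num
  | succ n ih =>
    refine ih.trans ?_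
    rw [cbin_succ_eq (n + 1), mul_pow, div_pow]
    push_cast
    have h := sq_nonneg (cbin (n + 1))
    rw [div_mul_eq_mul_div, div_mul_eq_mul_div, le_div_iff₀ (by positivity)]
    have : (n + 1) * (2 * ((n : ℝ) + 1 + 1)) ^ 2 ≤ (2 * ((n : ℝ) + 1) + 1) ^ 2 * (n + 1 + 1) := by
      ring_nf
      have := (Nat.cast_nonneg n : (0 : ℝ) ≤ n)
      nlinarith
    calc _ = cbin (n + 1) ^ 2 * 4 * ((n + 1) * (2 * ((n : ℝ) + 1 + 1)) ^ 2) := by ring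
      _ ≤ cbin (n + 1) ^ 2 * 4 * ((2 * ((n : ℝ) + 1) + 1) ^ 2 * (n + 1 + 1)) := by gcongr
      _ = _ := by ring

lemma cbin_le_one (n : ℕ) : cbin n ≤ 1 := by
  have h := cbin_sq_le n
  have := cbin_pos n
  have hn := (Nat.cast_nonneg n : (0 : ℝ) ≤ n)
  nlinarith [mul_nonneg (sq_nonneg (cbin n)) hn]

lemma tendsto_cbin : Tendsto cbin atTop (𝓝 0) := by
  have h : Tendsto (fun n : ℕ => cbin n ^ 2) atTop (𝓝 0) := by
    refine squeeze_zero (fun n => sq_nonneg _) (fun n => ?_) tendsto_one_div_add_atTop_nhds_zero_nat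
    rw [le_div_iff₀ (by positivity)]
    refine le_trans ?_ (cbin_sq_le n)
    gcongr
    linarith [(Nat.cast_nonneg n : (0 : ℝ) ≤ n)]
  have h2 := h.sqrt
  rw [Real.sqrt_zero] at h2
  exact h2.congr fun n => Real.sqrt_sq (cbin_pos n).le

lemma summable_cbin_div : Summable fun n : ℕ => cbin (n + 1) / ((n : ℝ) + 1) := by
  refine summable_of_sum_range_le (c := 2)
    (fun n => div_nonneg (cbin_pos _).le (by positivity)) fun N => ?_
  calc ∑ n ∈ Finset.range N, cbin (n + 1) / ((n : ℝ) + 1)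
      ≤ ∑ n ∈ Finset.range N, 2 * (cbin n - cbin (n + 1)) := by
        refine Finset.sum_le_sum fun n _ => ?_
        rw [cbin_sub, mul_div_assoc', div_le_div_iff₀ (by positivity) (by positivity)]
        nlinarith [cbin_pos (n + 1), (Nat.cast_nonneg n : (0 : ℝ) ≤ n)]
    _ = 2 * (cbin 0 - cbin N) := by rw [← Finset.mul_sum, Finset.sum_range_sub']
    _ ≤ 2 := by rw [cbin_zero]; linarith [cbin_pos N]

lemma norm_cbin (n : ℕ) : ‖(cbin n : ℂ)‖ = cbin n := by
  rw [Complex.norm_real, Real.norm_eq_abs, abs_of_pos (cbin_pos n)]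

lemma polyBdd_cbin : PolyBdd fun n => (cbin n : ℂ) :=
  PolyBdd.of_norm_le 1 fun n => by rw [norm_cbin]; exact cbin_le_one n

lemma cbin_mul_odd (n : ℕ) :
    (2 * (n : ℂ) + 1) * cbin n = 2 * (((n : ℂ) + 1) * (cbin (n + 1) : ℂ)) := by
  have := cbin_succ n
  rw [← mul_assoc]
  exact_mod_cast this.symm

/-- The central binomial series is `(1 - s) ^ (-1/2)`: both sides satisfy `2 (1 - s) q' = q`. -/
lemma one_sub_mul_ps_cbin_sq {s : ℝ} (hs : s ∈ Set.Ioo (0 : ℝ) 1) :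
    (1 - (s : ℂ)) * ps (fun n => (cbin n : ℂ)) s ^ 2 = 1 := by
  set q := ps (fun n => (cbin n : ℂ)) with hq
  have hode : ∀ t ∈ Set.Ioo (0 : ℝ) 1, 2 * (1 - (t : ℂ)) *
      ps (fun n => ((n : ℂ) + 1) * (cbin (n + 1) : ℂ)) t = q t := by
    intro t ht
    have ht' := abs_lt_one_of_mem ht
    have h1 : ps (fun n => (n : ℂ) * (cbin n : ℂ)) t
        = t * ps (fun n => ((n : ℂ) + 1) * (cbin (n + 1) : ℂ)) t := by
      rw [ps_eq_add polyBdd_cbin.natMul ht']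
      simp
    have h2 : 2 * ps (fun n => ((n : ℂ) + 1) * (cbin (n + 1) : ℂ)) t
        = 2 * ps (fun n => (n : ℂ) * (cbin n : ℂ)) t + q t := by
      rw [hq, ← ps_const_mul, ← ps_const_mul, ← ps_add (polyBdd_cbin.natMul.const_mul 2)
        polyBdd_cbin ht']
      congr 1
      ext n
      rw [← cbin_mul_odd]
      ring
    linear_combination h2 + 2 * h1
  refine eqOn_of_hasDerivAt (F := fun t : ℝ => (1 - (t : ℂ)) * q t ^ 2) (G := fun _ => 1)
    (h := fun _ => 0) (l := 1) ?_ (fun t _ => hasDerivAt_const _ _) ?_ tendsto_const_nhds s hs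
  · intro t ht
    have hd := hasDerivAt_ps polyBdd_cbin (abs_lt_one_of_mem ht)
    have h1 : HasDerivAt (fun t : ℝ => 1 - (t : ℂ)) (-1) t := by
      simpa using (Complex.ofRealCLM.hasDerivAt (x := t)).const_sub 1
    convert! h1.mul (hd.pow 2) using 1
    have := hode t ht
    simp only [Nat.cast_ofNat, Nat.add_one_sub_one, pow_one, Pi.pow_apply, ← hq]
    linear_combination (-q t) * this
  · have h1 : Tendsto (fun t : ℝ => 1 - (t : ℂ)) (𝓝[>] 0) (𝓝 (1 - ((0 : ℝ) : ℂ))) :=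
      (Continuous.tendsto (by fun_prop) 0).mono_left nhdsWithin_le_nhds
    have := h1.mul ((tendsto_ps_zero polyBdd_cbin).pow 2)
    simpa [cbin_zero] using this

lemma norm_ps_le_of_cbin {c : ℕ → ℂ} {C : ℝ} (h : ∀ n, ‖c n‖ ≤ C * cbin n) {t : ℝ}
    (ht : t ∈ Set.Ioo (0 : ℝ) 1) : ‖ps c t‖ ≤ C / √(1 - t) := by
  have hs := polyBdd_cbin.summable (abs_lt_one_of_mem ht)
  have hr : HasSum (fun n => cbin n * t ^ n) (∑' n, cbin n * t ^ n) := by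
    refine Summable.hasSum ?_
    exact_mod_cast hs
  have hq : ps (fun n => (cbin n : ℂ)) t = ((∑' n, cbin n * t ^ n : ℝ) : ℂ) := by
    rw [ps]
    push_cast
    rfl
  have h1 := one_sub_mul_ps_cbin_sq ht
  rw [hq] at h1
  have h2 : (1 - t) * (∑' n, cbin n * t ^ n) ^ 2 = 1 := by exact_mod_cast h1
  have h0 : 0 ≤ ∑' n, cbin n * t ^ n :=
    tsum_nonneg fun n => mul_nonneg (cbin_pos n).le (pow_nonneg ht.1.le n)
  have h3 : ∑' n, cbin n * t ^ n = 1 / √(1 - t) := by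
    have hpos : 0 < 1 - t := by linarith [ht.2]
    rw [eq_div_iff (Real.sqrt_ne_zero'.mpr hpos)]
    refine (sq_eq_sq₀ (by positivity) zero_le_one).mp ?_
    rw [mul_pow, Real.sq_sqrt hpos.le]
    linarith
  rw [div_eq_mul_one_div, ← h3]
  refine tsum_of_norm_bounded (hr.mul_left C) fun n => ?_
  rw [norm_mul, norm_pow, Complex.norm_real, Real.norm_eq_abs, abs_of_pos ht.1, ← mul_assoc]
  gcongr
  · exact pow_nonneg ht.1.le n
  · exact h n

/-! ### Iterated integrals with poles at zero and at roots of unity -/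

/-- The density of the differential form attached to the letter `a`: `dt / t` for `a = 0`,
and `a dt / (1 - a t) = -d log (1 - a t)` for `a ≠ 0`. -/
noncomputable def letterForm (a : ℂ) (t : ℝ) : ℂ :=
  if a = 0 then 1 / (t : ℂ) else a / (1 - a * t)

lemma letterForm_zero (t : ℝ) : letterForm 0 t = 1 / (t : ℂ) := if_pos rfl

lemma letterForm_of_ne {a : ℂ} (ha : a ≠ 0) (t : ℝ) : letterForm a t = a / (1 - a * t) :=
  if_neg ha

/-- The Taylor coefficients at `0` of the iterated integral `iterInt w`. -/
noncomputable def iterCoeff : List ℂ → ℕ → ℂ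
  | [], n => if n = 0 then 1 else 0
  | a :: w, n =>
      if a = 0 then iterCoeff w n / n
      else (∑ j ∈ Finset.range n, a ^ (n - j) * iterCoeff w j) / n

/-- The iterated integral from `0` to `t` of the forms `letterForm a`, for the letters `a` of the
word `w`; the first letter is the outermost form. It is defined by its power series. -/
noncomputable def iterInt (w : List ℂ) : ℝ → ℂ := ps (iterCoeff w)

/-- Words whose letters are `0` or `N`-th roots of unity and whose last letter is not `0`, so that
the iterated integral converges at the lower end point `0`. -/
def AdmWord (N : ℕ) : List ℂ → Prop
  | [] => True
  | a :: w => (a = 0 ∧ w ≠ [] ∨ a ^ N = 1) ∧ AdmWord N w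

lemma iterCoeff_cons_zero (a : ℂ) (w : List ℂ) : iterCoeff (a :: w) 0 = 0 := by
  simp [iterCoeff]

lemma iterCoeff_zero_of_ne_nil {w : List ℂ} (hw : w ≠ []) : iterCoeff w 0 = 0 := by
  cases w with
  | nil => exact absurd rfl hw
  | cons a w => exact iterCoeff_cons_zero a w

lemma admWord_one {N : ℕ} : AdmWord N [1] := ⟨Or.inr (one_pow N), trivial⟩

lemma iterInt_nil (t : ℝ) : iterInt [] t = 1 := by
  rw [iterInt, ps, tsum_eq_single 0]
  · simp [iterCoeff]
  · intro n hn
    simp [iterCoeff, hn]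

section
variable {N : ℕ} [NeZero N]

lemma norm_eq_one_of_pow {a : ℂ} (h : a ^ N = 1) : ‖a‖ = 1 :=
  Complex.norm_eq_one_of_pow_eq_one h (NeZero.ne N)

lemma ne_zero_of_pow_eq {a : ℂ} (h : a ^ N = 1) : a ≠ 0 := by
  rintro rfl
  simp [zero_pow (NeZero.ne N)] at h

/-- The central binomial coefficients are a convenient majorant: by `sum_cbin`, the recursion for
`iterCoeff` reproduces them up to a factor `2`. -/
lemma norm_iterCoeff_le {w : List ℂ} (hw : AdmWord N w) (n : ℕ) :
    ‖iterCoeff w n‖ ≤ 2 ^ w.length * cbin n := by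
  induction w generalizing n with
  | nil =>
    by_cases hn : n = 0
    · simp [iterCoeff, hn, cbin_zero]
    · simpa [iterCoeff, hn] using (cbin_pos n).le
  | cons a w ih =>
    have ih := ih hw.2
    have hp := cbin_pos n
    rw [List.length_cons, pow_succ]
    rcases Nat.eq_zero_or_pos n with rfl | hn
    · rw [iterCoeff_cons_zero, norm_zero]
      positivity
    have hn1 : (1 : ℝ) ≤ n := by exact_mod_cast hn
    by_cases ha : a = 0
    · rw [iterCoeff, if_pos ha, norm_div, Complex.norm_natCast]
      calc ‖iterCoeff w n‖ / n ≤ ‖iterCoeff w n‖ := div_le_self (norm_nonneg _) hn1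
        _ ≤ 2 ^ w.length * cbin n := ih n
        _ ≤ _ := by gcongr; linarith [pow_pos (two_pos (α := ℝ)) w.length]
    · have ha1 : ‖a‖ = 1 := norm_eq_one_of_pow (hw.1.resolve_left fun h => ha h.1)
      rw [iterCoeff, if_neg ha, norm_div, Complex.norm_natCast, div_le_iff₀ (by linarith)]
      calc ‖∑ j ∈ Finset.range n, a ^ (n - j) * iterCoeff w j‖
          ≤ ∑ j ∈ Finset.range n, 2 ^ w.length * cbin j := by
            refine norm_sum_le_of_le _ fun j _ => ?_
            rw [norm_mul, norm_pow, ha1, one_pow, one_mul]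
            exact ih j
        _ = _ := by rw [← Finset.mul_sum, sum_cbin]; ring

lemma polyBdd_iterCoeff {w : List ℂ} (hw : AdmWord N w) : PolyBdd (iterCoeff w) :=
  PolyBdd.of_norm_le (2 ^ w.length) fun n => (norm_iterCoeff_le hw n).trans
    (mul_le_of_le_one_right (by positivity) (cbin_le_one n))

lemma norm_iterInt_le {w : List ℂ} (hw : AdmWord N w) {t : ℝ} (ht : t ∈ Set.Ioo (0 : ℝ) 1) :
    ‖iterInt w t‖ ≤ 2 ^ w.length / √(1 - t) :=
  norm_ps_le_of_cbin (norm_iterCoeff_le hw) ht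

lemma tendsto_iterInt_zero {w : List ℂ} (hw : AdmWord N w) (hne : w ≠ []) :
    Tendsto (iterInt w) (𝓝[>] 0) (𝓝 0) := by
  rw [← iterCoeff_zero_of_ne_nil hne]
  exact tendsto_ps_zero (polyBdd_iterCoeff hw)

lemma one_sub_mul_ne_zero {a : ℂ} (ha : a ^ N = 1) {t : ℝ} (ht : t ∈ Set.Ioo (0 : ℝ) 1) :
    1 - a * t ≠ 0 := by
  intro h
  have h1 : a * t = 1 := (sub_eq_zero.mp h).symm
  have h2 : ‖a * t‖ = t := by
    rw [norm_mul, norm_eq_one_of_pow ha, one_mul, Complex.norm_real, Real.norm_eq_abs,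
      abs_of_pos ht.1]
  rw [h1, norm_one] at h2
  exact ht.2.ne h2.symm

lemma hasDerivAt_iterInt {a : ℂ} {w : List ℂ} (hw : AdmWord N (a :: w)) {t : ℝ}
    (ht : t ∈ Set.Ioo (0 : ℝ) 1) :
    HasDerivAt (iterInt (a :: w)) (letterForm a t * iterInt w t) t := by
  have ht' := abs_lt_one_of_mem ht
  have hb := polyBdd_iterCoeff hw
  have hbw := polyBdd_iterCoeff hw.2
  have ht0 : (t : ℂ) ≠ 0 := by exact_mod_cast ht.1.ne'
  refine (hasDerivAt_ps hb ht').congr_deriv (Eq.symm ?_)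
  by_cases ha : a = 0
  · have hne : w ≠ [] := by
      rcases hw.1 with h | h
      · exact h.2
      · exact absurd ha (ne_zero_of_pow_eq h)
    rw [ha, letterForm_zero, iterInt, ps_eq_add hbw ht', iterCoeff_zero_of_ne_nil hne, zero_add,
      ← mul_assoc, one_div, inv_mul_cancel₀ ht0, one_mul]
    congr 1
    ext n
    rw [iterCoeff, if_pos rfl]
    push_cast
    have : (n : ℂ) + 1 ≠ 0 := by exact_mod_cast n.succ_ne_zero
    field_simp
  · have haN : a ^ N = 1 := hw.1.resolve_left fun h => ha h.1
    have h1 := one_sub_mul_ne_zero haN ht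
    set d : ℕ → ℂ := fun n => ((n : ℂ) + 1) * iterCoeff (a :: w) (n + 1) with hd
    have hds : ∀ n, d n = ∑ j ∈ Finset.range (n + 1), a ^ (n + 1 - j) * iterCoeff w j := by
      intro n
      have : (n : ℂ) + 1 ≠ 0 := by exact_mod_cast n.succ_ne_zero
      rw [hd]
      simp only [iterCoeff, if_neg ha]
      push_cast
      field_simp
    have hd0 : d 0 = a * iterCoeff w 0 := by simp [hds]
    have hrec : ∀ n, d (n + 1) = a * iterCoeff w (n + 1) + a * d n := by
      intro n
      rw [hds, hds, Finset.sum_range_succ, add_comm, Finset.mul_sum]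
      congr 1
      · simp
      · refine Finset.sum_congr rfl fun j hj => ?_
        rw [← mul_assoc, ← pow_succ']
        congr 2
        have := Finset.mem_range.mp hj
        omega
    have hdb : PolyBdd d := hb.deriv
    have e1 := ps_eq_add hdb ht'
    have e2 : ps (fun n => d (n + 1)) t = a * ps (fun n => iterCoeff w (n + 1)) t + a * ps d t := by
      rw [← ps_const_mul, ← ps_const_mul,
        ← ps_add (hbw.shift.const_mul a) (hdb.const_mul a) ht']
      congr 1
      ext n
      exact hrec n
    have e3 := ps_eq_add hbw ht'
    rw [letterForm_of_ne ha, iterInt, div_mul_eq_mul_div, div_eq_iff h1]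
    rw [hd0, e2] at e1
    linear_combination a * e3 - e1

end

lemma iterInt_one {t : ℝ} (ht : t ∈ Set.Ioo (0 : ℝ) 1) :
    iterInt [1] t = ((-Real.log (1 - t) : ℝ) : ℂ) := by
  refine eqOn_of_hasDerivAt (h := fun t => letterForm 1 t * iterInt [] t) (l := 0)
    (F := iterInt [1]) (G := fun t => ((-Real.log (1 - t) : ℝ) : ℂ))
    (fun t ht => hasDerivAt_iterInt (N := 1) admWord_one ht) (fun t ht => ?_)
    (tendsto_iterInt_zero (N := 1) admWord_one (by simp)) ?_ t ht
  · have h1 : 1 - t ≠ 0 := by linarith [ht.2]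
    have h := (((hasDerivAt_id t).const_sub 1).log h1).neg.ofReal_comp
    refine h.congr_deriv ?_
    rw [iterInt_nil, letterForm_of_ne one_ne_zero]
    simp [neg_div]
  · have h : ContinuousAt (fun t : ℝ => ((-Real.log (1 - t) : ℝ) : ℂ)) 0 := by
      refine Complex.continuous_ofReal.continuousAt.comp (ContinuousAt.neg ?_)
      exact ContinuousAt.log (by fun_prop) (by norm_num)
    have := h.tendsto.mono_left (nhdsWithin_le_nhds (s := Set.Ioi (0 : ℝ)))
    simpa using this

lemma tendsto_sqrt_mul_log_pow (m : ℕ) :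
    Tendsto (fun t : ℝ => √(1 - t) * |Real.log (1 - t)| ^ m) (𝓝[<] 1) (𝓝 0) := by
  have hsub : Tendsto (fun t : ℝ => 1 - t) (𝓝[<] 1) (𝓝[>] 0) := by
    refine tendsto_nhdsWithin_iff.mpr ⟨?_, ?_⟩
    · have : Tendsto (fun t : ℝ => 1 - t) (𝓝 1) (𝓝 (1 - 1)) := Continuous.tendsto (by fun_prop) 1
      rw [sub_self] at this
      exact this.mono_left nhdsWithin_le_nhds
    · filter_upwards [self_mem_nhdsWithin] with t ht
      simpa using ht
  have key : Tendsto (fun x : ℝ => √x * |Real.log x| ^ m) (𝓝[>] 0) (𝓝 0) := by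
    rcases Nat.eq_zero_or_pos m with rfl | hm
    · have : Tendsto (fun x : ℝ => √x) (𝓝 0) (𝓝 (√0)) := Real.continuous_sqrt.tendsto 0
      simpa using this.mono_left (nhdsWithin_le_nhds (s := Set.Ioi (0 : ℝ)))
    · have hm' : (0 : ℝ) < m := by exact_mod_cast hm
      have h := ((tendsto_log_mul_rpow_nhdsGT_zero (r := 1 / (2 * m)) (by positivity)).abs).pow m
      rw [abs_zero, zero_pow hm.ne'] at h
      refine h.congr' ?_
      filter_upwards [self_mem_nhdsWithin] with x hx
      have hx0 : (0 : ℝ) < x := hx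
      rw [abs_mul, mul_pow, abs_of_pos (Real.rpow_pos_of_pos hx0 _), ← Real.rpow_mul_natCast hx0.le,
        Real.sqrt_eq_rpow, mul_comm]
      congr 2
      field_simp
  exact key.comp hsub

lemma tendsto_iterInt_one : Tendsto (fun t => ‖iterInt [1] t‖) (𝓝[<] 1) atTop := by
  have hsub : Tendsto (fun t : ℝ => 1 - t) (𝓝[<] 1) (𝓝[≠] 0) := by
    refine tendsto_nhdsWithin_iff.mpr ⟨?_, ?_⟩
    · have : Tendsto (fun t : ℝ => 1 - t) (𝓝 1) (𝓝 (1 - 1)) := Continuous.tendsto (by fun_prop) 1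
      rw [sub_self] at this
      exact this.mono_left nhdsWithin_le_nhds
    · filter_upwards [self_mem_nhdsWithin] with t ht
      have : t < 1 := ht
      simp only [Set.mem_compl_iff, Set.mem_singleton_iff]
      linarith
  have h := tendsto_abs_atBot_atTop.comp (Real.tendsto_log_nhdsNE_zero.comp hsub)
  refine h.congr' ?_
  filter_upwards [Ioo_mem_nhdsLT (zero_lt_one (α := ℝ))] with t ht
  rw [iterInt_one ht, Complex.norm_real, Real.norm_eq_abs, abs_neg]
  rfl

section
variable {N : ℕ} [NeZero N]

lemma exists_norm_letterForm_le {a : ℂ} (ha : a = 0 ∨ a ^ N = 1) (h1 : a ≠ 1) :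
    ∃ M : ℝ, 0 ≤ M ∧ ∀ t ∈ Set.Ico (1 / 2 : ℝ) 1, ‖letterForm a t‖ ≤ M := by
  have hc : ContinuousOn (letterForm a) (Set.Icc (1 / 2 : ℝ) 1) := by
    by_cases h0 : a = 0
    · have : letterForm a = fun t : ℝ => 1 / (t : ℂ) := by
        ext t
        rw [h0, letterForm_zero]
      rw [this]
      refine ContinuousOn.div (by fun_prop) (by fun_prop) fun t ht => ?_
      have : t ≠ 0 := by linarith [ht.1]
      exact_mod_cast this
    · have : letterForm a = fun t : ℝ => a / (1 - a * t) := by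
        ext t
        rw [letterForm_of_ne h0]
      rw [this]
      refine ContinuousOn.div (by fun_prop) (by fun_prop) fun t ht => ?_
      rcases ht.2.lt_or_eq with h | h
      · exact one_sub_mul_ne_zero (ha.resolve_left h0) ⟨by linarith [ht.1], h⟩
      · rw [h, Complex.ofReal_one, mul_one]
        exact sub_ne_zero.mpr h1.symm
  obtain ⟨M, hM⟩ := isCompact_Icc.exists_bound_of_continuousOn hc
  exact ⟨max M 0, le_max_right _ _,
    fun t ht => (hM t ⟨ht.1, ht.2.le⟩).trans (le_max_left _ _)⟩

/-- An iterated integral whose outermost letter is not `1` approaches its value at `1` faster than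
any negative power of the logarithm: its derivative is `O((1 - t) ^ (-1/2))`. -/
lemma tendsto_iterInt_sub_mul_pow {a : ℂ} {w : List ℂ} (hw : AdmWord N (a :: w)) (h1 : a ≠ 1)
    {A : ℂ} (hA : Tendsto (iterInt (a :: w)) (𝓝[<] 1) (𝓝 A)) (m : ℕ) :
    Tendsto (fun t => (iterInt (a :: w) t - A) * iterInt [1] t ^ m) (𝓝[<] 1) (𝓝 0) := by
  obtain ⟨M, hM0, hM⟩ := exists_norm_letterForm_le (N := N) (hw.1.imp_left And.left) h1
  set C : ℝ := M * 2 ^ w.length with hC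
  have hbd : ∀ t ∈ Set.Ico (1 / 2 : ℝ) 1, ∀ r ∈ Set.Ioo t 1,
      ‖iterInt (a :: w) r - iterInt (a :: w) t‖ ≤ 2 * C * √(1 - t) := by
    intro t ht r hr
    have hmem : ∀ s ∈ Set.Icc t r, s ∈ Set.Ioo (0 : ℝ) 1 := fun s hs =>
      ⟨by linarith [hs.1, ht.1], by linarith [hs.2, hr.2]⟩
    have hder : ∀ s ∈ Set.Icc t r, HasDerivAt (fun s => iterInt (a :: w) s - iterInt (a :: w) t)
        (letterForm a s * iterInt w s) s := fun s hs =>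
      (hasDerivAt_iterInt hw (hmem s hs)).sub_const _
    have hB : ∀ s ∈ Set.Icc t r, HasDerivAt (fun s => 2 * C * (√(1 - t) - √(1 - s)))
        (C / √(1 - s)) s := by
      intro s hs
      have hpos : 0 < 1 - s := by linarith [(hmem s hs).2]
      have := ((((hasDerivAt_id s).const_sub 1).sqrt hpos.ne').const_sub
        (√(1 - t))).const_mul (2 * C)
      refine this.congr_deriv ?_
      have : √(1 - s) ≠ 0 := Real.sqrt_ne_zero'.mpr hpos
      simp only [id]
      field_simp
    have := image_norm_le_of_norm_deriv_right_le_deriv_boundary'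
      (fun s hs => (hder s hs).continuousAt.continuousWithinAt)
      (fun s hs => (hder s ⟨hs.1, hs.2.le⟩).hasDerivWithinAt)
      (by simp) (fun s hs => (hB s hs).continuousAt.continuousWithinAt)
      (fun s hs => (hB s ⟨hs.1, hs.2.le⟩).hasDerivWithinAt)
      (fun s hs => by
        have hs' := hmem s ⟨hs.1, hs.2.le⟩
        rw [norm_mul, hC, mul_div_assoc]
        exact mul_le_mul (hM s ⟨ht.1.trans hs.1, hs'.2⟩) (norm_iterInt_le hw.2 hs')
          (norm_nonneg _) hM0)
      (Set.right_mem_Icc.mpr hr.1.le)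
    refine this.trans ?_
    have hC0 : 0 ≤ C := by positivity
    nlinarith [mul_nonneg hC0 (Real.sqrt_nonneg (1 - r))]
  have hrate : ∀ t ∈ Set.Ico (1 / 2 : ℝ) 1, ‖iterInt (a :: w) t - A‖ ≤ 2 * C * √(1 - t) := by
    intro t ht
    rw [norm_sub_rev]
    refine le_of_tendsto (hA.sub_const _).norm ?_
    filter_upwards [Ioo_mem_nhdsLT ht.2] with r hr using hbd t ht r hr
  have h0 := (tendsto_sqrt_mul_log_pow m).const_mul (2 * C)
  rw [mul_zero] at h0
  refine squeeze_zero_norm' ?_ h0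
  filter_upwards [Ioo_mem_nhdsLT (show (1 / 2 : ℝ) < 1 by norm_num)] with t ht
  rw [norm_mul, norm_pow, iterInt_one ⟨by linarith [ht.1], ht.2⟩, Complex.norm_real,
    Real.norm_eq_abs, abs_neg, ← mul_assoc]
  exact mul_le_mul_of_nonneg_right (hrate t ⟨ht.1.le, ht.2⟩) (by positivity)

end

/-! ### Insertion of the letter `1` -/

/-- The words obtained by inserting the letter `1` at one place, with multiplicity. -/
def insertOne : List ℂ → List (List ℂ)
  | [] => [[1]]
  | a :: w => (1 :: a :: w) :: (insertOne w).map (a :: ·)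

lemma length_of_mem_insertOne {w x : List ℂ} (h : x ∈ insertOne w) : x.length = w.length + 1 := by
  induction w generalizing x with
  | nil => simp [insertOne] at h; simp [h]
  | cons a w ih =>
    simp only [insertOne, List.mem_cons, List.mem_map] at h
    rcases h with rfl | ⟨y, hy, rfl⟩
    · simp
    · simp [ih hy]

section
variable {N : ℕ}

lemma admWord_of_mem_insertOne {w x : List ℂ} (hw : AdmWord N w) (h : x ∈ insertOne w) :
    AdmWord N x := by
  induction w generalizing x with
  | nil =>
    simp only [insertOne, List.mem_singleton] at h
    subst h
    exact ⟨Or.inr (one_pow N), trivial⟩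
  | cons a w ih =>
    simp only [insertOne, List.mem_cons, List.mem_map] at h
    rcases h with rfl | ⟨y, hy, rfl⟩
    · exact ⟨Or.inr (one_pow N), hw⟩
    · refine ⟨hw.1.imp_left fun h => ⟨h.1, ?_⟩, ih hw.2 hy⟩
      rintro rfl
      simpa using length_of_mem_insertOne hy

lemma hasDerivAt_list_sum {ι : Type*} (l : List ι) (f f' : ι → ℝ → ℂ) (t : ℝ)
    (h : ∀ i ∈ l, HasDerivAt (f i) (f' i t) t) :
    HasDerivAt (fun s => (l.map fun i => f i s).sum) (l.map fun i => f' i t).sum t := by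
  induction l with
  | nil => simpa using hasDerivAt_const t (0 : ℂ)
  | cons i l ih =>
    simp only [List.map_cons, List.sum_cons]
    exact (h i (by simp)).add (ih fun j hj => h j (by simp [hj]))

lemma tendsto_list_sum_zero {ι : Type*} (l : List ι) (f : ι → ℝ → ℂ) (F : Filter ℝ)
    (h : ∀ i ∈ l, Tendsto (f i) F (𝓝 0)) :
    Tendsto (fun s => (l.map fun i => f i s).sum) F (𝓝 0) := by
  induction l with
  | nil => simpa using tendsto_const_nhds
  | cons i l ih =>
    simp only [List.map_cons, List.sum_cons]
    simpa using (h i (by simp)).add (ih fun j hj => h j (by simp [hj]))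

variable [NeZero N]

/-- The shuffle product of the one-letter word `1` with an arbitrary word. -/
lemma sum_iterInt_insertOne {w : List ℂ} (hw : AdmWord N w) :
    ∀ t ∈ Set.Ioo (0 : ℝ) 1,
      ((insertOne w).map fun x => iterInt x t).sum = iterInt [1] t * iterInt w t := by
  induction w with
  | nil => simp [insertOne, iterInt_nil]
  | cons a w ih =>
    have ih := ih hw.2
    have hadm1 : AdmWord N (1 :: a :: w) := ⟨Or.inr (one_pow N), hw⟩
    have hadm : ∀ x ∈ insertOne w, AdmWord N (a :: x) := fun x hx =>
      admWord_of_mem_insertOne hw (by simp [insertOne, hx])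
    refine eqOn_of_hasDerivAt (l := 0)
      (F := fun t => ((insertOne (a :: w)).map fun x => iterInt x t).sum)
      (G := fun t => iterInt [1] t * iterInt (a :: w) t)
      (h := fun t => letterForm 1 t * iterInt (a :: w) t
        + letterForm a t * (iterInt [1] t * iterInt w t)) ?_ ?_ ?_ ?_
    · intro t ht
      simp only [insertOne, List.map_cons, List.sum_cons, List.map_map]
      refine (hasDerivAt_iterInt hadm1 ht).add ?_
      have := hasDerivAt_list_sum (insertOne w) (fun x => iterInt (a :: x))
        (fun x t => letterForm a t * iterInt x t) t fun x hx => hasDerivAt_iterInt (hadm x hx) ht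
      rw [List.sum_map_mul_left, ih t ht] at this
      exact this
    · intro t ht
      convert! (hasDerivAt_iterInt (N := N) admWord_one ht).mul (hasDerivAt_iterInt hw ht) using 1
      rw [iterInt_nil]
      ring
    · refine tendsto_list_sum_zero _ _ _ fun x hx => ?_
      refine tendsto_iterInt_zero (admWord_of_mem_insertOne hw hx) ?_
      rintro rfl
      simpa using length_of_mem_insertOne hx
    · simpa using (tendsto_iterInt_zero (N := N) admWord_one (by simp)).mul
        (tendsto_iterInt_zero hw (by simp))

/-- Inserting the letter `1` into `1, …, 1, w` either prolongs the initial run, or goes into `w`. -/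
lemma sum_insertOne_replicate (F : List ℂ → ℂ) (j : ℕ) (w : List ℂ) :
    ((insertOne (List.replicate j 1 ++ w)).map F).sum
      = j * F (List.replicate (j + 1) 1 ++ w)
        + ((insertOne w).map fun x => F (List.replicate j 1 ++ x)).sum := by
  induction j generalizing F with
  | zero => simp
  | succ j ih =>
    rw [List.replicate_succ, List.cons_append, insertOne, List.map_cons, List.sum_cons,
      List.map_map, ih]
    simp only [Function.comp_apply, ← List.cons_append, ← List.replicate_succ]
    push_cast
    ring

end

/-! ### Convergence of colored sums -/

/-- The entries of the list are positive exponents paired with `N`-th roots of unity. -/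
def ValidList (N : ℕ) (l : List (ℕ × ℂ)) : Prop := ∀ a ∈ l, 0 < a.1 ∧ a.2 ^ N = 1

lemma ValidList.tail {N : ℕ} {a : ℕ × ℂ} {l : List (ℕ × ℂ)} (h : ValidList N (a :: l)) :
    ValidList N l := fun b hb => h b (List.mem_cons_of_mem _ hb)

lemma ValidList.cons {N k : ℕ} {z : ℂ} {l : List (ℕ × ℂ)} (hk : 0 < k) (hz : z ^ N = 1)
    (h : ValidList N l) : ValidList N ((k, z) :: l) := by
  intro b hb
  rcases List.mem_cons.mp hb with rfl | hb
  · exact ⟨hk, hz⟩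
  · exact h b hb

lemma coloredSum_succ (k : ℕ) (z : ℂ) (l : List (ℕ × ℂ)) (n : ℕ) :
    coloredSum ((k, z) :: l) (n + 1)
      = coloredSum ((k, z) :: l) n + z ^ (n + 1) / ((n : ℂ) + 1) ^ k * coloredSum l n := by
  rw [coloredSum, coloredSum, Finset.sum_range_succ]

lemma norm_natCast_succ (j : ℕ) : ‖(j : ℂ) + 1‖ = (j : ℝ) + 1 := by
  have := Complex.norm_natCast (j + 1)
  push_cast at this
  exact this

section
variable {N : ℕ} [NeZero N]

lemma norm_term_le {k : ℕ} (hk : 0 < k) {z : ℂ} (hz : z ^ N = 1) {x : ℂ} {C : ℝ} {j : ℕ}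
    (hx : ‖x‖ ≤ C * (2 * ((j : ℝ) + 1) * cbin (j + 1))) :
    ‖z ^ (j + 1) / ((j : ℂ) + 1) ^ k * x‖ ≤ 2 * C * cbin (j + 1) := by
  have h1 : (1 : ℝ) ≤ (j : ℝ) + 1 := by linarith [(Nat.cast_nonneg j : (0 : ℝ) ≤ j)]
  rw [norm_mul, norm_div, norm_pow, norm_pow, norm_eq_one_of_pow hz, one_pow, norm_natCast_succ,
    one_div_mul_eq_div, div_le_iff₀ (by positivity)]
  have hc : 0 ≤ 2 * C * cbin (j + 1) := by
    have := (norm_nonneg x).trans hx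
    by_contra hneg
    nlinarith
  calc ‖x‖ ≤ 2 * C * cbin (j + 1) * ((j : ℝ) + 1) := by linarith
    _ ≤ _ := by
      gcongr
      exact le_self_pow₀ h1 hk.ne'

lemma norm_coloredSum_le {l : List (ℕ × ℂ)} (hl : ValidList N l) (n : ℕ) :
    ‖coloredSum l n‖ ≤ 2 ^ l.length * (2 * ((n : ℝ) + 1) * cbin (n + 1)) := by
  have hsum : ∑ j ∈ Finset.range (n + 1), cbin j = 2 * ((n : ℝ) + 1) * cbin (n + 1) := by
    have := sum_cbin (n + 1)
    push_cast at this
    exact this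
  rw [← hsum]
  clear hsum
  induction l generalizing n with
  | nil =>
    rw [coloredSum, norm_one, List.length_nil, pow_zero, one_mul, Finset.sum_range_succ', cbin_zero]
    linarith [Finset.sum_nonneg fun j (_ : j ∈ Finset.range n) => (cbin_pos (j + 1)).le]
  | cons a l ih =>
    obtain ⟨k, z⟩ := a
    have hkz := hl (k, z) (by simp)
    have ih := ih hl.tail
    rw [coloredSum]
    calc ‖∑ j ∈ Finset.range n, z ^ (j + 1) / ((j : ℂ) + 1) ^ k * coloredSum l j‖
        ≤ ∑ j ∈ Finset.range n, 2 * 2 ^ l.length * cbin (j + 1) := by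
          refine norm_sum_le_of_le _ fun j _ => norm_term_le hkz.1 hkz.2 ((ih j).trans_eq ?_)
          have := sum_cbin (j + 1)
          push_cast at this
          rw [this]
      _ = 2 ^ (l.length + 1) * ∑ j ∈ Finset.range n, cbin (j + 1) := by
          rw [← Finset.mul_sum, pow_succ']
      _ ≤ _ := by
          rw [List.length_cons, Finset.sum_range_succ', cbin_zero]
          gcongr
          linarith

lemma norm_coloredSum_sub_le {l : List (ℕ × ℂ)} (hl : ValidList N l) (n : ℕ) :
    ‖coloredSum l (n + 1) - coloredSum l n‖ ≤ 2 ^ l.length * cbin (n + 1) := by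
  cases l with
  | nil => simpa [coloredSum] using (cbin_pos _).le
  | cons a l =>
    obtain ⟨k, z⟩ := a
    obtain ⟨hk, hz⟩ : 0 < k ∧ z ^ N = 1 := hl (k, z) (by simp)
    have h := norm_term_le hk hz (norm_coloredSum_le hl.tail n)
    rwa [coloredSum_succ, add_sub_cancel_left, List.length_cons, pow_succ' 2]

end

/-- Dirichlet's test for a null sequence of bounded variation against the powers of `z ≠ 1`. -/
lemma exists_tendsto_sum_pow_mul {z : ℂ} (hz : ‖z‖ = 1) (hz1 : z ≠ 1) {d : ℕ → ℂ}
    (hd : Tendsto d atTop (𝓝 0)) (hv : Summable fun n => ‖d (n + 1) - d n‖) :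
    ∃ x, Tendsto (fun n => ∑ j ∈ Finset.range n, z ^ (j + 1) * d j) atTop (𝓝 x) := by
  have hz' : 1 - z ≠ 0 := sub_ne_zero.mpr hz1.symm
  have habel : ∀ n, ∑ j ∈ Finset.range n, z ^ (j + 1) * d j
      = (z * d 0 + ∑ j ∈ Finset.range n, z ^ (j + 2) * (d (j + 1) - d j) - z ^ (n + 1) * d n)
        / (1 - z) := by
    intro n
    rw [eq_div_iff hz']
    induction n with
    | zero => simp
    | succ n ih =>
      rw [Finset.sum_range_succ, Finset.sum_range_succ, add_mul, ih]
      ring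
  have hs : Summable fun j => z ^ (j + 2) * (d (j + 1) - d j) := by
    refine Summable.of_norm ?_
    simpa [hz] using hv
  have h0 : Tendsto (fun n => z ^ (n + 1) * d n) atTop (𝓝 0) := by
    refine squeeze_zero_norm (fun n => ?_) (tendsto_zero_iff_norm_tendsto_zero.mp hd)
    rw [norm_mul, norm_pow, hz, one_pow, one_mul]
  simp_rw [habel]
  exact ⟨_, ((hs.hasSum.tendsto_sum_nat.const_add _).sub h0).div_const _⟩

section
variable {N : ℕ} [NeZero N]

lemma exists_tendsto_coloredSum {l : List (ℕ × ℂ)} (hl : ValidList N l)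
    (hh : l.head? ≠ some (1, 1)) : ∃ x, Tendsto (coloredSum l) atTop (𝓝 x) := by
  cases l with
  | nil => exact ⟨1, tendsto_const_nhds⟩
  | cons a l =>
    obtain ⟨k, z⟩ := a
    obtain ⟨hk, hz⟩ := hl (k, z) (by simp)
    have hb := norm_coloredSum_le hl.tail
    rcases (Nat.succ_le_of_lt hk).eq_or_lt with hk1 | hk1
    · have hk1 : k = 1 := hk1.symm
      subst hk1
      have hz1 : z ≠ 1 := by
        rintro rfl
        exact hh rfl
      have hpos : ∀ j : ℕ, (0 : ℝ) < (j : ℝ) + 1 := fun j => by positivity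
      have hd0 : Tendsto (fun j : ℕ => coloredSum l j / ((j : ℂ) + 1)) atTop (𝓝 0) := by
        have h0 : Tendsto (fun j => 2 ^ l.length * 2 * cbin (j + 1)) atTop (𝓝 0) := by
          simpa using (tendsto_cbin.comp (tendsto_add_atTop_nat 1)).const_mul (2 ^ l.length * 2)
        refine squeeze_zero_norm (fun j => ?_) h0
        rw [norm_div, norm_natCast_succ, div_le_iff₀ (hpos j)]
        linarith [hb j]
      have hvar : Summable fun j : ℕ => ‖coloredSum l (j + 1) / (((j + 1 : ℕ) : ℂ) + 1)
          - coloredSum l j / ((j : ℂ) + 1)‖ := by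
        refine Summable.of_nonneg_of_le (fun _ => norm_nonneg _) (fun j => ?_)
          (summable_cbin_div.mul_left (3 * 2 ^ l.length))
        have hj1 : (j : ℂ) + 1 ≠ 0 := by exact_mod_cast j.succ_ne_zero
        have hj2 : ((j + 1 : ℕ) : ℂ) + 1 ≠ 0 := by exact_mod_cast (j + 1).succ_ne_zero
        have hsplit : coloredSum l (j + 1) / (((j + 1 : ℕ) : ℂ) + 1)
              - coloredSum l j / ((j : ℂ) + 1)
            = ((coloredSum l (j + 1) - coloredSum l j) - coloredSum l j / ((j : ℂ) + 1))
              / (((j + 1 : ℕ) : ℂ) + 1) := by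
          field_simp
          push_cast
          ring
        have hc := cbin_pos (j + 1)
        rw [hsplit, norm_div, norm_natCast_succ, ← mul_div_assoc]
        refine div_le_div₀ (by positivity) ?_ (hpos j) (by push_cast; linarith)
        refine (norm_sub_le _ _).trans ?_
        have h1 := norm_coloredSum_sub_le hl.tail j
        have h2 : ‖coloredSum l j / ((j : ℂ) + 1)‖ ≤ 2 ^ l.length * 2 * cbin (j + 1) := by
          rw [norm_div, norm_natCast_succ, div_le_iff₀ (hpos j)]
          linarith [hb j]
        linarith
      obtain ⟨x, hx⟩ := exists_tendsto_sum_pow_mul (norm_eq_one_of_pow hz) hz1 hd0 hvar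
      refine ⟨x, hx.congr fun n => ?_⟩
      rw [coloredSum]
      refine Finset.sum_congr rfl fun j _ => ?_
      rw [pow_one]
      ring
    · have hs : Summable fun j : ℕ => z ^ (j + 1) / ((j : ℂ) + 1) ^ k * coloredSum l j := by
        refine Summable.of_norm_bounded (summable_cbin_div.mul_left (2 * 2 ^ l.length)) fun j => ?_
        obtain ⟨k, rfl⟩ : ∃ k', k = k' + 1 := ⟨k - 1, by omega⟩
        have h1 := norm_term_le (N := N) (k := k) (by omega) hz (hb j)
        have h2 : z ^ (j + 1) / ((j : ℂ) + 1) ^ (k + 1) * coloredSum l j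
            = (z ^ (j + 1) / ((j : ℂ) + 1) ^ k * coloredSum l j) / ((j : ℂ) + 1) := by
          have hj1 : (j : ℂ) + 1 ≠ 0 := by exact_mod_cast j.succ_ne_zero
          rw [pow_succ ((j : ℂ) + 1)]
          field_simp
        rw [h2, norm_div, norm_natCast_succ, ← mul_div_assoc]
        gcongr
      exact ⟨_, hs.hasSum.tendsto_sum_nat⟩

end

/-! ### The stuffle product -/

/-- The `ℚ`-span of the sequences `coloredSum l` over the lists of weight `w`. -/
noncomputable def colSpan (N w : ℕ) : Submodule ℚ (ℕ → ℂ) :=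
  Submodule.span ℚ {F | ∃ l, ValidList N l ∧ (l.map Prod.fst).sum = w ∧ F = coloredSum l}

/-- The `ℚ`-span of the sequences `coloredSum l` over the lists of weight `w` that do not start
with `(1, 1)`. -/
noncomputable def colSpanAdm (N w : ℕ) : Submodule ℚ (ℕ → ℂ) :=
  Submodule.span ℚ {F | ∃ l, ValidList N l ∧ l.head? ≠ some (1, 1) ∧ (l.map Prod.fst).sum = w ∧
    F = coloredSum l}

/-- The summation operator that prefixes the pair `(k, z)` to a colored sum. -/
noncomputable def sumOp (k : ℕ) (z : ℂ) : (ℕ → ℂ) →ₗ[ℚ] (ℕ → ℂ) where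
  toFun F n := ∑ j ∈ Finset.range n, z ^ (j + 1) / ((j : ℂ) + 1) ^ k * F j
  map_add' F G := by
    ext n
    simp only [Pi.add_apply, mul_add, Finset.sum_add_distrib]
  map_smul' q F := by
    ext n
    simp only [Pi.smul_apply, Finset.smul_sum, mul_smul_comm, RingHom.id_apply]

lemma sumOp_mem {N k w : ℕ} {z : ℂ} (hk : 0 < k) (hz : z ^ N = 1) {F : ℕ → ℂ}
    (hF : F ∈ colSpan N w) : sumOp k z F ∈ colSpan N (k + w) := by
  have h : colSpan N w ≤ (colSpan N (k + w)).comap (sumOp k z) := by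
    refine Submodule.span_le.mpr ?_
    rintro _ ⟨l, hl, rfl, rfl⟩
    exact Submodule.subset_span ⟨(k, z) :: l, hl.cons hk hz, by simp, rfl⟩
  exact h hF

lemma sumOp_mem_adm {N k w : ℕ} {z : ℂ} (hk : 0 < k) (hz : z ^ N = 1) (h1 : (k, z) ≠ (1, 1))
    {F : ℕ → ℂ} (hF : F ∈ colSpan N w) : sumOp k z F ∈ colSpanAdm N (k + w) := by
  have h : colSpan N w ≤ (colSpanAdm N (k + w)).comap (sumOp k z) := by
    refine Submodule.span_le.mpr ?_
    rintro _ ⟨l, hl, rfl, rfl⟩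
    exact Submodule.subset_span ⟨(k, z) :: l, hl.cons hk hz, by simpa using h1, by simp, rfl⟩
  exact h hF

/-- The recursion of the quasi-shuffle product: the two largest summation indices are compared. -/
lemma coloredSum_mul_coloredSum (k k' : ℕ) (z z' : ℂ) (l l' : List (ℕ × ℂ)) :
    coloredSum ((k, z) :: l) * coloredSum ((k', z') :: l')
      = sumOp k z (coloredSum l * coloredSum ((k', z') :: l'))
        + sumOp k' z' (coloredSum ((k, z) :: l) * coloredSum l')
        + sumOp (k + k') (z * z') (coloredSum l * coloredSum l') := by
  ext n
  simp only [Pi.mul_apply, Pi.add_apply]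
  induction n with
  | zero => simp [coloredSum, sumOp]
  | succ n ih =>
    rw [coloredSum_succ, coloredSum_succ]
    simp only [sumOp, LinearMap.coe_mk, AddHom.coe_mk, Finset.sum_range_succ] at ih ⊢
    simp only [Pi.mul_apply] at ih ⊢
    rw [mul_pow, pow_add ((n : ℂ) + 1) k k']
    have hn : (n : ℂ) + 1 ≠ 0 := by exact_mod_cast n.succ_ne_zero
    rw [add_mul, mul_add, mul_add, ih, ← div_mul_div_comm]
    ring

lemma coloredSum_mem_colSpan {N : ℕ} {l : List (ℕ × ℂ)} (hl : ValidList N l) :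
    coloredSum l ∈ colSpan N (l.map Prod.fst).sum :=
  Submodule.subset_span ⟨l, hl, rfl, rfl⟩

lemma coloredSum_nil : coloredSum [] = 1 := rfl

lemma coloredSum_mul_mem (N : ℕ) : ∀ l l' : List (ℕ × ℂ), ValidList N l → ValidList N l' →
    coloredSum l * coloredSum l' ∈ colSpan N ((l.map Prod.fst).sum + (l'.map Prod.fst).sum)
  | [], l', _, hl' => by
    rw [coloredSum_nil, one_mul]
    simpa using coloredSum_mem_colSpan hl'
  | a :: l, [], hl, _ => by
    rw [coloredSum_nil, mul_one]
    simpa using coloredSum_mem_colSpan hl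
  | (k, z) :: l, (k', z') :: l', hl, hl' => by
    obtain ⟨hk, hz⟩ := hl (k, z) (by simp)
    obtain ⟨hk', hz'⟩ := hl' (k', z') (by simp)
    rw [coloredSum_mul_coloredSum]
    have h1 := sumOp_mem hk hz (coloredSum_mul_mem N l ((k', z') :: l') hl.tail hl')
    have h2 := sumOp_mem hk' hz' (coloredSum_mul_mem N ((k, z) :: l) l' hl hl'.tail)
    have h3 := sumOp_mem (N := N) (z := z * z') (show 0 < k + k' by omega)
      (by rw [mul_pow, hz, hz', one_mul]) (coloredSum_mul_mem N l l' hl.tail hl'.tail)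
    simp only [List.map_cons, List.sum_cons] at h1 h2 h3 ⊢
    convert! add_mem (add_mem h1 ?_) ?_ using 2
    · ring
    · convert! h2 using 2
      ring
    · convert! h3 using 2
      ring
  termination_by l l' => l.length + l'.length

lemma coloredSum_mul_mem_adm {N : ℕ} {l l' : List (ℕ × ℂ)} (hl : ValidList N l)
    (hl' : ValidList N l') (hh : l.head? ≠ some (1, 1)) (hh' : l'.head? ≠ some (1, 1)) :
    coloredSum l * coloredSum l'
      ∈ colSpanAdm N ((l.map Prod.fst).sum + (l'.map Prod.fst).sum) := by
  cases l with
  | nil =>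
    rw [coloredSum_nil, one_mul]
    exact Submodule.subset_span ⟨l', hl', hh', by simp, rfl⟩
  | cons a l =>
    cases l' with
    | nil =>
      rw [coloredSum_nil, mul_one]
      exact Submodule.subset_span ⟨a :: l, hl, hh, by simp, rfl⟩
    | cons a' l' =>
      obtain ⟨k, z⟩ := a
      obtain ⟨k', z'⟩ := a'
      obtain ⟨hk, hz⟩ := hl (k, z) (by simp)
      obtain ⟨hk', hz'⟩ := hl' (k', z') (by simp)
      rw [coloredSum_mul_coloredSum]
      have h1 := sumOp_mem_adm hk hz (by simpa using hh)
        (coloredSum_mul_mem N l ((k', z') :: l') hl.tail hl')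
      have h2 := sumOp_mem_adm hk' hz' (by simpa using hh')
        (coloredSum_mul_mem N ((k, z) :: l) l' hl hl'.tail)
      have h3 := sumOp_mem_adm (N := N) (z := z * z') (show 0 < k + k' by omega)
        (by rw [mul_pow, hz, hz', one_mul])
        (fun h => by have := (Prod.mk.inj h).1; omega)
        (coloredSum_mul_mem N l l' hl.tail hl'.tail)
      simp only [List.map_cons, List.sum_cons] at h1 h2 h3 ⊢
      convert! add_mem (add_mem h1 ?_) ?_ using 2
      · ring
      · convert! h2 using 2
        ring
      · convert! h3 using 2
        ring

lemma exists_tendsto_of_mem_colSpanAdm {N w : ℕ} [NeZero N] {F : ℕ → ℂ}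
    (hF : F ∈ colSpanAdm N w) : ∃ x ∈ CMZV N w, Tendsto F atTop (𝓝 x) := by
  induction hF using Submodule.span_induction with
  | mem F h =>
    obtain ⟨l, hl, hh, hw, rfl⟩ := h
    obtain ⟨x, hx⟩ := exists_tendsto_coloredSum hl hh
    exact ⟨x, Submodule.subset_span ⟨l, hl, hh, hw, hx⟩, hx⟩
  | zero => exact ⟨0, zero_mem _, tendsto_const_nhds⟩
  | add F G _ _ hF hG =>
    obtain ⟨x, hx, hFx⟩ := hF
    obtain ⟨y, hy, hGy⟩ := hG
    exact ⟨x + y, add_mem hx hy, hFx.add hGy⟩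
  | smul q F _ hF =>
    obtain ⟨x, hx, hFx⟩ := hF
    exact ⟨q • x, Submodule.smul_mem _ q hx, hFx.const_smul q⟩

/-- The colored multiple zeta values of a given level form a graded algebra. -/
lemma mul_mem_CMZV {N a b : ℕ} [NeZero N] {x y : ℂ} (hx : x ∈ CMZV N a) (hy : y ∈ CMZV N b) :
    x * y ∈ CMZV N (a + b) := by
  induction hx using Submodule.span_induction with
  | mem x h =>
    obtain ⟨l, hl, hh, rfl, hlx⟩ := h
    induction hy using Submodule.span_induction with
    | mem y h =>
      obtain ⟨l', hl', hh', rfl, hly⟩ := h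
      obtain ⟨z, hz, ht⟩ :=
        exists_tendsto_of_mem_colSpanAdm (coloredSum_mul_mem_adm hl hl' hh hh')
      rwa [tendsto_nhds_unique (hlx.mul hly) ht]
    | zero => rw [mul_zero]; exact zero_mem _
    | add y z _ _ h1 h2 => rw [mul_add]; exact add_mem h1 h2
    | smul q y _ h => rw [mul_smul_comm]; exact Submodule.smul_mem _ q h
  | zero => rw [zero_mul]; exact zero_mem _
  | add y z _ _ h1 h2 => rw [add_mul]; exact add_mem h1 h2
  | smul q y _ h => rw [smul_mul_assoc]; exact Submodule.smul_mem _ q h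

lemma one_mem_CMZV (N : ℕ) : (1 : ℂ) ∈ CMZV N 0 :=
  Submodule.subset_span ⟨[], by simp, by simp, by simp, tendsto_const_nhds⟩

/-! ### Iterated integrals as colored sums -/

/-- Multiply the first root of unity of the list by `y`. -/
noncomputable def twist (y : ℂ) : List (ℕ × ℂ) → List (ℕ × ℂ)
  | [] => []
  | (k, z) :: l => (k, y * z) :: l

lemma coloredSum_twist (y : ℂ) (l : List (ℕ × ℂ)) (n : ℕ) :
    coloredSum (twist y l) n
      = coloredSum l 0 + ∑ j ∈ Finset.range n,
          y ^ (j + 1) * (coloredSum l (j + 1) - coloredSum l j) := by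
  cases l with
  | nil => simp [twist, coloredSum]
  | cons a l =>
    obtain ⟨k, z⟩ := a
    rw [twist, show coloredSum ((k, z) :: l) 0 = 0 by simp [coloredSum], zero_add, coloredSum]
    refine Finset.sum_congr rfl fun j _ => ?_
    rw [coloredSum_succ, mul_pow]
    ring

/-- The partial sums of the power series of an iterated integral, at `1`, are colored sums. -/
lemma exists_coloredSum_eq {N : ℕ} [NeZero N] {w : List ℂ} (hw : AdmWord N w) :
    ∃ l, ValidList N l ∧ (l.map Prod.fst).sum = w.length ∧
      (l.head? = some (1, 1) → w.head? = some 1) ∧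
      ∀ n, coloredSum l n = ∑ j ∈ Finset.range (n + 1), iterCoeff w j := by
  induction w with
  | nil =>
    refine ⟨[], by simp [ValidList], by simp, by simp, fun n => ?_⟩
    simp [coloredSum, iterCoeff]
  | cons a w ih =>
    obtain ⟨l, hl, hsum, hhead, hc⟩ := ih hw.2
    have hdiff : ∀ n, coloredSum l (n + 1) - coloredSum l n = iterCoeff w (n + 1) := fun n => by
      rw [hc, hc, Finset.sum_range_succ _ (n + 1)]
      ring
    by_cases ha : a = 0
    · have hne : w ≠ [] := by
        rcases hw.1 with h | h
        · exact h.2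
        · exact absurd ha (ne_zero_of_pow_eq h)
      cases l with
      | nil =>
        simp only [List.map_nil, List.sum_nil] at hsum
        exact absurd (List.length_eq_zero_iff.mp hsum.symm) hne
      | cons b l =>
        obtain ⟨k, z⟩ := b
        obtain ⟨hk, hz⟩ := hl (k, z) (by simp)
        refine ⟨(k + 1, z) :: l, hl.tail.cons (by omega) hz, ?_, ?_, fun n => ?_⟩
        · simp only [List.map_cons, List.sum_cons, List.length_cons] at hsum ⊢
          omega
        · intro h
          simp only [List.head?_cons, Option.some.injEq, Prod.mk.injEq] at h
          omega
        · rw [Finset.sum_range_succ', iterCoeff_cons_zero, add_zero, coloredSum]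
          refine Finset.sum_congr rfl fun j _ => ?_
          have hj : (j : ℂ) + 1 ≠ 0 := by exact_mod_cast j.succ_ne_zero
          rw [iterCoeff, if_pos ha, ← hdiff, coloredSum_succ, pow_succ ((j : ℂ) + 1)]
          push_cast
          field_simp
          ring
    · have haN : a ^ N = 1 := hw.1.resolve_left fun h => ha h.1
      refine ⟨(1, a) :: twist a⁻¹ l, ValidList.cons one_pos haN ?_, ?_, ?_, fun n => ?_⟩
      · cases l with
        | nil => exact hl
        | cons b l =>
          obtain ⟨k, z⟩ := b
          obtain ⟨hk, hz⟩ := hl (k, z) (by simp)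
          exact hl.tail.cons hk (by rw [mul_pow, inv_pow, haN, hz, inv_one, one_mul])
      · have : ((twist a⁻¹ l).map Prod.fst).sum = (l.map Prod.fst).sum := by
          cases l <;> simp [twist]
        simp only [List.map_cons, List.sum_cons, List.length_cons, this, hsum]
        omega
      · intro h
        simp only [List.head?_cons, Option.some.injEq, Prod.mk.injEq] at h
        simp [h.2]
      · rw [Finset.sum_range_succ', iterCoeff_cons_zero, add_zero, coloredSum]
        refine Finset.sum_congr rfl fun j _ => ?_
        have hj : (j : ℂ) + 1 ≠ 0 := by exact_mod_cast j.succ_ne_zero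
        have htw : coloredSum (twist a⁻¹ l) j
            = ∑ i ∈ Finset.range (j + 1), a⁻¹ ^ i * iterCoeff w i := by
          rw [coloredSum_twist, Finset.sum_range_succ', hc 0, add_comm]
          simp [hdiff]
        rw [iterCoeff, if_neg ha, htw, pow_one, div_mul_eq_mul_div, Finset.mul_sum]
        push_cast
        congr 1
        refine Finset.sum_congr rfl fun i hi => ?_
        have hi' : i ≤ j + 1 := (Finset.mem_range.mp hi).le
        rw [← mul_assoc, inv_pow, pow_sub₀ a ha hi']

lemma exists_tendsto_iterInt {N : ℕ} [NeZero N] {w : List ℂ} (hw : AdmWord N w)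
    (hh : w.head? ≠ some 1) :
    ∃ A ∈ CMZV N w.length, Tendsto (iterInt w) (𝓝[<] 1) (𝓝 A) := by
  obtain ⟨l, hl, hsum, hhead, hc⟩ := exists_coloredSum_eq hw
  obtain ⟨A, hA⟩ := exists_tendsto_coloredSum hl fun h => hh (hhead h)
  refine ⟨A, Submodule.subset_span ⟨l, hl, fun h => hh (hhead h), hsum, hA⟩, ?_⟩
  have h1 : Tendsto (fun n => ∑ j ∈ Finset.range n, iterCoeff w j) atTop (𝓝 A) := by
    rw [← tendsto_add_atTop_iff_nat 1]
    exact hA.congr hc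
  exact tendsto_map'_iff.mp (Complex.tendsto_tsum_powerSeries_nhdsWithin_lt h1)

/-! ### Regularization at the end point `1` -/

/-- Up to an error that vanishes faster than any negative power of the logarithm as `t → 1`, the
function is a polynomial in `iterInt [1] t = - log (1 - t)` whose coefficient at degree `j` is a
colored multiple zeta value of weight `w - j`. -/
def HasReg (N w : ℕ) (f : ℝ → ℂ) : Prop :=
  ∃ P : Polynomial ℂ, P.natDegree ≤ w ∧ (∀ j ≤ w, P.coeff j ∈ CMZV N (w - j)) ∧
    ∀ m : ℕ, Tendsto (fun t => (f t - P.eval (iterInt [1] t)) * iterInt [1] t ^ m)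
      (𝓝[<] 1) (𝓝 0)

section
variable {N w : ℕ}

lemma HasReg.congr {f g : ℝ → ℂ} (hf : HasReg N w f) (h : ∀ t ∈ Set.Ioo (0 : ℝ) 1, f t = g t) :
    HasReg N w g := by
  obtain ⟨P, h1, h2, h3⟩ := hf
  refine ⟨P, h1, h2, fun m => (h3 m).congr' ?_⟩
  filter_upwards [Ioo_mem_nhdsLT (zero_lt_one (α := ℝ))] with t ht
  rw [h t ht]

lemma HasReg.zero : HasReg N w fun _ => 0 :=
  ⟨0, by simp, fun j _ => by simp, fun m => by simp⟩

lemma HasReg.add {f g : ℝ → ℂ} (hf : HasReg N w f) (hg : HasReg N w g) :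
    HasReg N w fun t => f t + g t := by
  obtain ⟨P, h1, h2, h3⟩ := hf
  obtain ⟨Q, k1, k2, k3⟩ := hg
  refine ⟨P + Q, (Polynomial.natDegree_add_le _ _).trans (max_le h1 k1), fun j hj => ?_,
    fun m => ?_⟩
  · rw [Polynomial.coeff_add]
    exact add_mem (h2 j hj) (k2 j hj)
  · have := (h3 m).add (k3 m)
    rw [add_zero] at this
    refine this.congr fun t => ?_
    rw [Polynomial.eval_add]
    ring

lemma ratCast_mem_CMZV (q : ℚ) : (q : ℂ) ∈ CMZV N 0 := by
  have := Submodule.smul_mem _ q (one_mem_CMZV N)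
  rwa [Rat.smul_def, mul_one] at this

lemma HasReg.log_mul {f : ℝ → ℂ} (hf : HasReg N w f) :
    HasReg N (w + 1) fun t => iterInt [1] t * f t := by
  obtain ⟨P, h1, h2, h3⟩ := hf
  refine ⟨Polynomial.X * P, Polynomial.natDegree_mul_le.trans ?_, fun j hj => ?_, fun m => ?_⟩
  · rw [Polynomial.natDegree_X]
    omega
  · cases j with
    | zero => simp
    | succ j =>
      rw [Polynomial.coeff_X_mul, Nat.add_sub_add_right]
      exact h2 j (by omega)
  · refine (h3 (m + 1)).congr fun t => ?_
    rw [Polynomial.eval_mul, Polynomial.eval_X]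
    ring

lemma HasReg.list_sum {ι : Type*} (l : List ι) (f : ι → ℝ → ℂ) (h : ∀ i ∈ l, HasReg N w (f i)) :
    HasReg N w fun t => (l.map fun i => f i t).sum := by
  induction l with
  | nil => simpa using HasReg.zero
  | cons i l ih =>
    simp only [List.map_cons, List.sum_cons]
    exact (h i (by simp)).add (ih fun j hj => h j (by simp [hj]))

lemma admWord_replicate_append {v : List ℂ} (hv : AdmWord N v) (j : ℕ) :
    AdmWord N (List.replicate j 1 ++ v) := by
  induction j with
  | zero => simpa using hv
  | succ j ih => exact ⟨Or.inr (one_pow N), ih⟩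

/-- A function with a regularized expansion that has a limit at `1` has a colored multiple zeta
value as its limit: the logarithm is unbounded, so that only the constant term survives. -/
lemma HasReg.limit_mem {f : ℝ → ℂ} (hf : HasReg N w f) {A : ℂ}
    (hA : Tendsto f (𝓝[<] 1) (𝓝 A)) : A ∈ CMZV N w := by
  obtain ⟨P, -, h2, h3⟩ := hf
  have h0 := h3 0
  simp only [pow_zero, mul_one] at h0
  have hP : Tendsto (fun t => P.eval (_root_.iterInt [1] t)) (𝓝[<] 1) (𝓝 A) := by
    simpa using hA.sub h0
  have hdeg : P.degree ≤ 0 := by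
    by_contra hlt
    exact not_tendsto_nhds_of_tendsto_atTop
      (P.tendsto_norm_atTop (not_le.mp hlt) tendsto_iterInt_one) _ hP.norm
  rw [Polynomial.eq_C_of_degree_le_zero hdeg] at hP
  simp only [Polynomial.eval_C] at hP
  rw [tendsto_nhds_unique hP tendsto_const_nhds]
  simpa using h2 0 (Nat.zero_le w)

variable [NeZero N]

lemma HasReg.const_mul {v : ℕ} {f : ℝ → ℂ} (hf : HasReg N w f) {κ : ℂ} (hκ : κ ∈ CMZV N v) :
    HasReg N (v + w) fun t => κ * f t := by
  obtain ⟨P, h1, h2, h3⟩ := hf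
  refine ⟨Polynomial.C κ * P, (Polynomial.natDegree_C_mul_le _ _).trans (by omega),
    fun j hj => ?_, fun m => ?_⟩
  · rw [Polynomial.coeff_C_mul]
    by_cases hjw : j ≤ w
    · have := mul_mem_CMZV hκ (h2 j hjw)
      rwa [← Nat.add_sub_assoc hjw] at this
    · rw [Polynomial.coeff_eq_zero_of_natDegree_lt (by omega), mul_zero]
      exact zero_mem _
  · have := (h3 m).const_mul κ
    rw [mul_zero] at this
    refine this.congr fun t => ?_
    rw [Polynomial.eval_mul, Polynomial.eval_C]
    ring

lemma HasReg.ratCast_mul {f : ℝ → ℂ} (hf : HasReg N w f) (q : ℚ) :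
    HasReg N w fun t => (q : ℂ) * f t := by
  have := hf.const_mul (ratCast_mem_CMZV (N := N) q)
  rwa [zero_add] at this

lemma HasReg.iterInt_of_head {v : List ℂ} (hv : AdmWord N v) (hh : v.head? ≠ some 1) :
    HasReg N v.length (iterInt v) := by
  obtain ⟨A, hA, hlim⟩ := exists_tendsto_iterInt hv hh
  refine ⟨Polynomial.C A, by simp, fun j hj => ?_, fun m => ?_⟩
  · rw [Polynomial.coeff_C]
    split_ifs with h
    · simpa [h] using hA
    · exact zero_mem _
  · simp only [Polynomial.eval_C]
    cases v with
    | nil =>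
      have : A = 1 := tendsto_nhds_unique hlim (by
        simp only [funext iterInt_nil]
        exact tendsto_const_nhds)
      simp [iterInt_nil, this]
    | cons a v => exact tendsto_iterInt_sub_mul_pow hv (by simpa using hh) hlim m

lemma insertOne_eq_cons (v : List ℂ) : insertOne v = (1 :: v) :: (insertOne v).tail := by
  cases v <;> rfl

lemma head_of_mem_tail_insertOne {v x : List ℂ} (hh : v.head? ≠ some 1)
    (hx : x ∈ (insertOne v).tail) : x.head? ≠ some 1 := by
  cases v with
  | nil => simp [insertOne] at hx
  | cons a v =>
    simp only [insertOne, List.tail_cons, List.mem_map] at hx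
    obtain ⟨y, -, rfl⟩ := hx
    simpa using hh

/-- Shuffle regularization: the leading letters `1` are removed one at a time with the help of
the shuffle product with the word `1`. -/
lemma HasReg.iterInt_replicate_append (j : ℕ) : ∀ v : List ℂ, AdmWord N v → v.head? ≠ some 1 →
    HasReg N (j + v.length) (iterInt (List.replicate j 1 ++ v)) := by
  induction j with
  | zero =>
    intro v hv hh
    simpa using HasReg.iterInt_of_head hv hh
  | succ j ih =>
    intro v hv hh
    have hj : ((j : ℂ) + 1) ≠ 0 := by exact_mod_cast j.succ_ne_zero
    have hA := (ih v hv hh).log_mul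
    have hB : HasReg N (j + v.length + 1) fun t =>
        ((insertOne v).tail.map fun x => iterInt (List.replicate j 1 ++ x) t).sum := by
      refine HasReg.list_sum _ (fun x => iterInt (List.replicate j 1 ++ x)) fun x hx => ?_
      have hx' := List.mem_of_mem_tail hx
      have := ih x (admWord_of_mem_insertOne hv hx') (head_of_mem_tail_insertOne hh hx)
      rwa [length_of_mem_insertOne hx', ← add_assoc] at this
    have hC := (hA.add (hB.ratCast_mul (-1))).ratCast_mul (1 / ((j : ℚ) + 1))
    rw [add_right_comm]
    refine hC.congr fun t ht => ?_
    have h1 := sum_iterInt_insertOne (admWord_replicate_append hv j) t ht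
    rw [sum_insertOne_replicate (fun x => iterInt x t), insertOne_eq_cons, List.map_cons,
      List.sum_cons] at h1
    have h2 : List.replicate j (1 : ℂ) ++ 1 :: v = List.replicate (j + 1) 1 ++ v := by
      rw [List.replicate_succ', List.append_assoc]
      rfl
    rw [h2] at h1
    rw [← h1]
    push_cast
    field_simp
    ring

lemma HasReg.iterInt {v : List ℂ} (hv : AdmWord N v) : HasReg N v.length (iterInt v) := by
  suffices h : ∃ j u, v = List.replicate j 1 ++ u ∧ AdmWord N u ∧ u.head? ≠ some 1 by
    obtain ⟨j, u, rfl, hu, hh⟩ := h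
    simpa using HasReg.iterInt_replicate_append j u hu hh
  induction v with
  | nil => exact ⟨0, [], by simp [AdmWord]⟩
  | cons a v ih =>
    by_cases ha : a = 1
    · obtain ⟨j, u, rfl, hu, hh⟩ := ih hv.2
      exact ⟨j + 1, u, by rw [ha]; rfl, hu, hh⟩
    · exact ⟨0, a :: v, rfl, hv, by simpa using ha⟩

end

/-! ### Spans of iterated integrals and their primitives -/

/-- The `ℚ`-span of the functions `κ * iterInt u`, where `κ` is a colored multiple zeta value of
level `N`, the word `u` is not empty, and the weight of `κ` and the length of `u` add up to `w`. -/
noncomputable def iterSpan (N w : ℕ) : Submodule ℚ (ℝ → ℂ) :=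
  Submodule.span ℚ {f | ∃ a κ u, κ ∈ CMZV N a ∧ AdmWord N u ∧ u ≠ [] ∧ a + u.length = w ∧
    f = fun t => κ * iterInt u t}

/-- The function agrees on `(0,1)` with an element of `iterSpan N w`. -/
def InIterSpan (N w : ℕ) (f : ℝ → ℂ) : Prop :=
  ∃ g ∈ iterSpan N w, ∀ t ∈ Set.Ioo (0 : ℝ) 1, f t = g t

/-- The function has on `(0,1)` a primitive in `iterSpan N w`. -/
def HasIterPrimitive (N w : ℕ) (h : ℝ → ℂ) : Prop :=
  ∃ G ∈ iterSpan N w, ∀ t ∈ Set.Ioo (0 : ℝ) 1, HasDerivAt G (h t) t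

/-- The `ℚ`-span of the densities `letterForm a` over the `N`-th roots of unity `a`. -/
noncomputable def unitForms (N : ℕ) : Submodule ℚ (ℝ → ℂ) :=
  Submodule.span ℚ {φ | ∃ a : ℂ, a ^ N = 1 ∧ φ = letterForm a}

/-- The `ℚ`-span of the densities `letterForm a` over all letters: zero and the `N`-th roots of
unity. -/
noncomputable def allForms (N : ℕ) : Submodule ℚ (ℝ → ℂ) :=
  Submodule.span ℚ {φ | ∃ a : ℂ, (a = 0 ∨ a ^ N = 1) ∧ φ = letterForm a}

lemma rat_smul_apply (q : ℚ) (f : ℝ → ℂ) (t : ℝ) : (q • f) t = (q : ℂ) * f t := by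
  rw [Pi.smul_apply, Rat.smul_def]

section
variable {N w : ℕ}

lemma InIterSpan.ratCast_mul {f : ℝ → ℂ} (q : ℚ) (hf : InIterSpan N w f) :
    InIterSpan N w fun t => (q : ℂ) * f t := by
  obtain ⟨F, hF, hfF⟩ := hf
  exact ⟨q • F, Submodule.smul_mem _ q hF, fun t ht => by rw [rat_smul_apply, ← hfF t ht]⟩

lemma HasIterPrimitive.congr {f g : ℝ → ℂ} (hf : HasIterPrimitive N w f)
    (h : ∀ t ∈ Set.Ioo (0 : ℝ) 1, g t = f t) : HasIterPrimitive N w g := by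
  obtain ⟨F, hF, hfF⟩ := hf
  exact ⟨F, hF, fun t ht => by rw [h t ht]; exact hfF t ht⟩

lemma HasIterPrimitive.zero : HasIterPrimitive N w fun _ => 0 :=
  ⟨0, zero_mem _, fun _ _ => hasDerivAt_const _ _⟩

lemma HasIterPrimitive.add {f g : ℝ → ℂ} (hf : HasIterPrimitive N w f)
    (hg : HasIterPrimitive N w g) : HasIterPrimitive N w fun t => f t + g t := by
  obtain ⟨F, hF, hfF⟩ := hf
  obtain ⟨G, hG, hgG⟩ := hg
  exact ⟨F + G, add_mem hF hG, fun t ht => (hfF t ht).add (hgG t ht)⟩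

lemma HasIterPrimitive.ratCast_mul {f : ℝ → ℂ} (q : ℚ) (hf : HasIterPrimitive N w f) :
    HasIterPrimitive N w fun t => (q : ℂ) * f t := by
  obtain ⟨F, hF, hfF⟩ := hf
  refine ⟨q • F, Submodule.smul_mem _ q hF, fun t ht => ?_⟩
  rw [show q • F = fun s => (q : ℂ) * F s from funext (rat_smul_apply q F)]
  exact (hfF t ht).const_mul _

lemma HasIterPrimitive.of_form {φ : ℝ → ℂ} {f : ℝ → ℂ} {S : Set (ℝ → ℂ)}
    (h : ∀ ψ ∈ S, HasIterPrimitive N w fun t => ψ t * f t) (hφ : φ ∈ Submodule.span ℚ S) :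
    HasIterPrimitive N w fun t => φ t * f t := by
  induction hφ using Submodule.span_induction with
  | mem ψ hψ => exact h ψ hψ
  | zero => exact HasIterPrimitive.zero.congr fun t _ => zero_mul _
  | add φ ψ _ _ h1 h2 => exact (h1.add h2).congr fun t _ => add_mul _ _ _
  | smul q φ _ h =>
    exact (h.ratCast_mul q).congr fun t _ => by rw [rat_smul_apply, mul_assoc]

variable [NeZero N]

lemma tendsto_zero_of_mem_iterSpan {f : ℝ → ℂ} (hf : f ∈ iterSpan N w) :
    Tendsto f (𝓝[>] 0) (𝓝 0) := by
  induction hf using Submodule.span_induction with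
  | mem f h =>
    obtain ⟨a, κ, u, -, hu, hne, -, rfl⟩ := h
    simpa using (tendsto_iterInt_zero hu hne).const_mul κ
  | zero => exact tendsto_const_nhds
  | add f g _ _ hf hg =>
    rw [← add_zero (0 : ℂ)]
    exact hf.add hg
  | smul q f _ hf =>
    have := hf.const_smul q
    rwa [smul_zero] at this

/-- A primitive is determined by its vanishing at `0`. -/
lemma HasIterPrimitive.inIterSpan {h F : ℝ → ℂ} (hh : HasIterPrimitive N w h)
    (hF : ∀ t ∈ Set.Ioo (0 : ℝ) 1, HasDerivAt F (h t) t) (hF0 : Tendsto F (𝓝[>] 0) (𝓝 0)) :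
    InIterSpan N w F := by
  obtain ⟨G, hG, hGh⟩ := hh
  exact ⟨G, hG, eqOn_of_hasDerivAt hF hGh hF0 (tendsto_zero_of_mem_iterSpan hG)⟩

/-- The limits at `1` of functions in the span are colored multiple zeta values. -/
lemma InIterSpan.limit_mem {f : ℝ → ℂ} (hf : InIterSpan N w f) {A : ℂ}
    (hA : Tendsto f (𝓝[<] 1) (𝓝 A)) : A ∈ CMZV N w := by
  obtain ⟨g, hg, hfg⟩ := hf
  have hreg : HasReg N w g := by
    clear hfg hA
    induction hg using Submodule.span_induction with
    | mem f h =>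
      obtain ⟨a, κ, u, hκ, hu, -, rfl, rfl⟩ := h
      exact (HasReg.iterInt hu).const_mul hκ
    | zero => exact HasReg.zero
    | add f g _ _ hf hg => exact hf.add hg
    | smul q f _ hf => exact (hf.ratCast_mul q).congr fun t _ => (rat_smul_apply q f t).symm
  refine hreg.limit_mem (hA.congr' ?_)
  filter_upwards [Ioo_mem_nhdsLT (zero_lt_one (α := ℝ))] with t ht using hfg t ht

lemma HasIterPrimitive.letterForm_mul {a : ℂ} (ha : a = 0 ∨ a ^ N = 1) {f : ℝ → ℂ}
    (hf : InIterSpan N w f) : HasIterPrimitive N (w + 1) fun t => letterForm a t * f t := by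
  obtain ⟨g, hg, hfg⟩ := hf
  refine HasIterPrimitive.congr (f := fun t => letterForm a t * g t) ?_
    fun t ht => by rw [hfg t ht]
  clear hfg
  induction hg using Submodule.span_induction with
  | mem g h =>
    obtain ⟨b, κ, u, hκ, hu, hne, rfl, rfl⟩ := h
    have hau : AdmWord N (a :: u) := ⟨ha.imp_left fun h => ⟨h, hne⟩, hu⟩
    refine ⟨fun t => κ * iterInt (a :: u) t,
      Submodule.subset_span ⟨b, κ, a :: u, hκ, hau, by simp, by simp [add_assoc], rfl⟩,
      fun t ht => ?_⟩
    exact ((hasDerivAt_iterInt hau ht).const_mul κ).congr_deriv (by ring)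
  | zero => exact HasIterPrimitive.zero.congr fun t _ => mul_zero _
  | add f g _ _ h1 h2 => exact (h1.add h2).congr fun t _ => mul_add _ _ _
  | smul q f _ h =>
    refine (h.ratCast_mul q).congr fun t _ => ?_
    rw [rat_smul_apply]
    ring

lemma HasIterPrimitive.letterForm_mul_const {a : ℂ} (ha : a ^ N = 1) {κ : ℂ}
    (hκ : κ ∈ CMZV N w) : HasIterPrimitive N (w + 1) fun t => letterForm a t * κ := by
  have hau : AdmWord N [a] := ⟨Or.inr ha, trivial⟩
  refine ⟨fun t => κ * iterInt [a] t,
    Submodule.subset_span ⟨w, κ, [a], hκ, hau, by simp, by simp, rfl⟩, fun t ht => ?_⟩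
  exact ((hasDerivAt_iterInt hau ht).const_mul κ).congr_deriv (by rw [iterInt_nil]; ring)

lemma HasIterPrimitive.form_mul {φ : ℝ → ℂ} (hφ : φ ∈ allForms N) {f : ℝ → ℂ}
    (hf : InIterSpan N w f) : HasIterPrimitive N (w + 1) fun t => φ t * f t := by
  refine HasIterPrimitive.of_form ?_ hφ
  rintro _ ⟨a, ha, rfl⟩
  exact HasIterPrimitive.letterForm_mul ha hf

lemma HasIterPrimitive.form_mul_const {φ : ℝ → ℂ} (hφ : φ ∈ unitForms N) {κ : ℂ}
    (hκ : κ ∈ CMZV N w) : HasIterPrimitive N (w + 1) fun t => φ t * κ := by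
  refine HasIterPrimitive.of_form ?_ hφ
  rintro _ ⟨a, ha, rfl⟩
  exact HasIterPrimitive.letterForm_mul_const ha hκ

end

lemma unitForms_le_allForms (N : ℕ) : unitForms N ≤ allForms N :=
  Submodule.span_mono fun _ ⟨a, ha, h⟩ => ⟨a, Or.inr ha, h⟩

/-! ### The rational parametrization of the sine -/

/-- The sine `2 t / (1 + t ^ 2)` of the angle `2 arctan t`. -/
noncomputable def ratSin (t : ℝ) : ℝ := 2 * t / (1 + t ^ 2)

/-- The cosine `(1 - t ^ 2) / (1 + t ^ 2)` of the angle `2 arctan t`. -/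
noncomputable def ratCos (t : ℝ) : ℝ := (1 - t ^ 2) / (1 + t ^ 2)

/-- The derivative `2 / (1 + t ^ 2)` of the angle `2 arctan t`. -/
noncomputable def angDeriv (t : ℝ) : ℝ := 2 / (1 + t ^ 2)

lemma ratSin_sq_add_ratCos_sq (t : ℝ) : ratSin t ^ 2 + ratCos t ^ 2 = 1 := by
  have : 1 + t ^ 2 ≠ 0 := by positivity
  unfold ratSin ratCos
  field_simp
  ring

lemma hasDerivAt_ratSin (t : ℝ) : HasDerivAt ratSin (angDeriv t * ratCos t) t := by
  have h0 : 1 + t ^ 2 ≠ 0 := by positivity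
  have h := ((hasDerivAt_id t).const_mul 2).div (((hasDerivAt_id t).pow 2).const_add 1) h0
  refine h.congr_deriv ?_
  simp only [id, angDeriv, ratCos, Pi.pow_apply]
  field_simp
  ring

lemma hasDerivAt_ratCos (t : ℝ) : HasDerivAt ratCos (-(angDeriv t * ratSin t)) t := by
  have h0 : 1 + t ^ 2 ≠ 0 := by positivity
  have h := (((hasDerivAt_id t).pow 2).const_sub 1).div (((hasDerivAt_id t).pow 2).const_add 1) h0
  refine h.congr_deriv ?_
  simp only [id, angDeriv, ratSin, Pi.pow_apply]
  field_simp
  ring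

lemma ratSin_pos {t : ℝ} (ht : t ∈ Set.Ioo (0 : ℝ) 1) : 0 < ratSin t := by
  have := ht.1
  unfold ratSin
  positivity

lemma ratCos_pos {t : ℝ} (ht : t ∈ Set.Ioo (0 : ℝ) 1) : 0 < ratCos t := by
  have h1 := ht.1
  have h2 := ht.2
  have h3 : 0 < 1 - t ^ 2 := by nlinarith
  unfold ratCos
  positivity

lemma ratSin_sq_mem {t : ℝ} (ht : t ∈ Set.Ioo (0 : ℝ) 1) : ratSin t ^ 2 ∈ Set.Ioo (0 : ℝ) 1 := by
  have h1 := ratSin_pos ht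
  have h2 := ratCos_pos ht
  have h3 := ratSin_sq_add_ratCos_sq t
  exact ⟨by positivity, by nlinarith⟩

lemma continuous_ratSin : Continuous ratSin :=
  continuous_iff_continuousAt.mpr fun t => (hasDerivAt_ratSin t).continuousAt

lemma continuous_ratCos : Continuous ratCos :=
  continuous_iff_continuousAt.mpr fun t => (hasDerivAt_ratCos t).continuousAt

lemma tendsto_ratSin_zero : Tendsto ratSin (𝓝[>] 0) (𝓝 0) := by
  have := continuous_ratSin.tendsto 0
  rw [show ratSin 0 = 0 by simp [ratSin]] at this
  exact this.mono_left nhdsWithin_le_nhds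

lemma tendsto_ratCos_zero : Tendsto ratCos (𝓝[>] 0) (𝓝 1) := by
  have := continuous_ratCos.tendsto 0
  rw [show ratCos 0 = 1 by simp [ratCos]] at this
  exact this.mono_left nhdsWithin_le_nhds

lemma tendsto_ratSin_one : Tendsto ratSin (𝓝[<] 1) (𝓝 1) := by
  have := continuous_ratSin.tendsto 1
  rw [show ratSin 1 = 1 by norm_num [ratSin]] at this
  exact this.mono_left nhdsWithin_le_nhds

/-- The angle form is `-i` times a rational combination of letters. -/
lemma letterForm_I_sub (t : ℝ) :
    letterForm Complex.I t - letterForm (-Complex.I) t = Complex.I * angDeriv t := by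
  have h1 : (1 : ℂ) + (t : ℂ) ^ 2 ≠ 0 := by
    have : (1 : ℝ) + t ^ 2 ≠ 0 := by positivity
    exact_mod_cast this
  have h2 : (1 - Complex.I * t) * (1 + Complex.I * t) = 1 + (t : ℂ) ^ 2 := by
    linear_combination (-(t : ℂ) ^ 2) * Complex.I_sq
  have h3 : 1 - Complex.I * (t : ℂ) ≠ 0 := fun h => h1 (by rw [← h2, h, zero_mul])
  have h4 : 1 + Complex.I * (t : ℂ) ≠ 0 := fun h => h1 (by rw [← h2, h, mul_zero])
  rw [letterForm_of_ne Complex.I_ne_zero, letterForm_of_ne (neg_ne_zero.mpr Complex.I_ne_zero),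
    neg_mul, sub_neg_eq_add, angDeriv]
  push_cast
  rw [← h2]
  field_simp
  ring

lemma letterForm_I_add (t : ℝ) :
    letterForm Complex.I t + letterForm (-Complex.I) t = -(angDeriv t * t : ℝ) := by
  have h1 : (1 : ℂ) + (t : ℂ) ^ 2 ≠ 0 := by
    have : (1 : ℝ) + t ^ 2 ≠ 0 := by positivity
    exact_mod_cast this
  have h2 : (1 - Complex.I * t) * (1 + Complex.I * t) = 1 + (t : ℂ) ^ 2 := by
    linear_combination (-(t : ℂ) ^ 2) * Complex.I_sq
  have h3 : 1 - Complex.I * (t : ℂ) ≠ 0 := fun h => h1 (by rw [← h2, h, zero_mul])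
  have h4 : 1 + Complex.I * (t : ℂ) ≠ 0 := fun h => h1 (by rw [← h2, h, mul_zero])
  rw [letterForm_of_ne Complex.I_ne_zero, letterForm_of_ne (neg_ne_zero.mpr Complex.I_ne_zero),
    neg_mul, sub_neg_eq_add, angDeriv]
  push_cast
  rw [← h2]
  field_simp
  linear_combination (2 * (t : ℂ)) * Complex.I_sq

lemma letterForm_one (t : ℝ) : letterForm 1 t = (1 / (1 - t) : ℝ) := by
  rw [letterForm_of_ne one_ne_zero]
  push_cast
  rw [one_mul]

lemma letterForm_neg_one (t : ℝ) : letterForm (-1) t = (-(1 / (1 + t)) : ℝ) := by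
  rw [letterForm_of_ne (by simp)]
  push_cast
  rw [neg_one_mul, sub_neg_eq_add, neg_div]

lemma letterForm_mem_unitForms {a : ℂ} (ha : a ^ 4 = 1) : letterForm a ∈ unitForms 4 :=
  Submodule.subset_span ⟨a, ha, rfl⟩

lemma neg_I_pow_four : (-Complex.I) ^ 4 = 1 := by
  rw [Even.neg_pow (by decide), Complex.I_pow_four]

/-- The form `i dθ`. -/
lemma exists_angForm : ∃ φ ∈ unitForms 4, ∀ t ∈ Set.Ioo (0 : ℝ) 1,
    φ t = Complex.I * angDeriv t :=
  ⟨letterForm Complex.I - letterForm (-Complex.I),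
    sub_mem (letterForm_mem_unitForms Complex.I_pow_four)
      (letterForm_mem_unitForms neg_I_pow_four), fun t _ => letterForm_I_sub t⟩

/-- The form `dx / x` for `x = sin θ`. -/
lemma exists_logForm : ∃ φ ∈ allForms 4, ∀ t ∈ Set.Ioo (0 : ℝ) 1,
    φ t = (angDeriv t * ratCos t / ratSin t : ℝ) := by
  refine ⟨letterForm 0 + (letterForm Complex.I + letterForm (-Complex.I)),
    add_mem (Submodule.subset_span ⟨0, Or.inl rfl, rfl⟩) (unitForms_le_allForms 4
      (add_mem (letterForm_mem_unitForms Complex.I_pow_four)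
        (letterForm_mem_unitForms neg_I_pow_four))), fun t ht => ?_⟩
  rw [Pi.add_apply, Pi.add_apply, letterForm_I_add, letterForm_zero]
  have h0 : t ≠ 0 := ht.1.ne'
  have h1 : 1 + t ^ 2 ≠ 0 := by positivity
  rw [show (1 : ℂ) / (t : ℂ) = ((1 / t : ℝ) : ℂ) by push_cast; rfl, ← Complex.ofReal_neg,
    ← Complex.ofReal_add]
  congr 1
  unfold angDeriv ratCos ratSin
  field_simp
  ring

/-- The form `dx / (1 - x ^ 2)` for `x = sin θ`. -/
lemma exists_oddForm : ∃ φ ∈ unitForms 4, ∀ t ∈ Set.Ioo (0 : ℝ) 1,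
    φ t = (angDeriv t / ratCos t : ℝ) := by
  refine ⟨letterForm 1 - letterForm (-1), sub_mem (letterForm_mem_unitForms (by norm_num))
    (letterForm_mem_unitForms (by norm_num)), fun t ht => ?_⟩
  rw [Pi.sub_apply, letterForm_one, letterForm_neg_one, ← Complex.ofReal_sub]
  congr 1
  have h1 : 1 + t ^ 2 ≠ 0 := by positivity
  have h2 : 1 - t ≠ 0 := by linarith [ht.2]
  have h3 : 1 + t ≠ 0 := by linarith [ht.1]
  have h4 : 1 - t ^ 2 ≠ 0 := by
    rw [show 1 - t ^ 2 = (1 - t) * (1 + t) by ring]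
    exact mul_ne_zero h2 h3
  unfold angDeriv ratCos
  field_simp
  ring

/-- The form `x dx / (1 - x ^ 2)` for `x = sin θ`. -/
lemma exists_evenForm : ∃ φ ∈ unitForms 4, ∀ t ∈ Set.Ioo (0 : ℝ) 1,
    φ t = (angDeriv t * ratSin t / ratCos t : ℝ) := by
  refine ⟨letterForm 1 + letterForm (-1) - (letterForm Complex.I + letterForm (-Complex.I)),
    sub_mem (add_mem (letterForm_mem_unitForms (by norm_num))
      (letterForm_mem_unitForms (by norm_num)))
      (add_mem (letterForm_mem_unitForms Complex.I_pow_four)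
        (letterForm_mem_unitForms neg_I_pow_four)), fun t ht => ?_⟩
  rw [Pi.sub_apply, Pi.add_apply, Pi.add_apply, letterForm_I_add, letterForm_one,
    letterForm_neg_one, ← Complex.ofReal_add, ← Complex.ofReal_neg, ← Complex.ofReal_sub]
  congr 1
  have h1 : 1 + t ^ 2 ≠ 0 := by positivity
  have h2 : 1 - t ≠ 0 := by linarith [ht.2]
  have h3 : 1 + t ≠ 0 := by linarith [ht.1]
  have h4 : 1 - t ^ 2 ≠ 0 := by
    rw [show 1 - t ^ 2 = (1 - t) * (1 + t) by ring]
    exact mul_ne_zero h2 h3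
  unfold angDeriv ratCos ratSin
  field_simp
  ring

/-! ### Power series in the square of the sine -/

lemma hasDerivAt_ps_sq {d : ℕ → ℂ} (hd : PolyBdd d) {t : ℝ} (ht : t ∈ Set.Ioo (0 : ℝ) 1) :
    HasDerivAt (fun t => ps d (ratSin t ^ 2))
      (2 * (angDeriv t * ratCos t * ratSin t : ℝ)
        * ps (fun n => ((n : ℂ) + 1) * d (n + 1)) (ratSin t ^ 2)) t := by
  have h := (hasDerivAt_ps hd (abs_lt_one_of_mem (ratSin_sq_mem ht))).scomp t
    ((hasDerivAt_ratSin t).pow 2)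
  refine h.congr_deriv ?_
  rw [Complex.real_smul]
  push_cast
  ring

lemma hasDerivAt_ps_sq_log {d : ℕ → ℂ} (hd : PolyBdd d) {t : ℝ} (ht : t ∈ Set.Ioo (0 : ℝ) 1) :
    HasDerivAt (fun t => ps d (ratSin t ^ 2))
      ((angDeriv t * ratCos t / ratSin t : ℝ) * ps (fun n => 2 * ((n : ℂ) * d n)) (ratSin t ^ 2))
      t := by
  refine (hasDerivAt_ps_sq hd ht).congr_deriv ?_
  have hs : (ratSin t : ℂ) ≠ 0 := by exact_mod_cast (ratSin_pos ht).ne'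
  rw [ps_const_mul, ps_eq_add hd.natMul (abs_lt_one_of_mem (ratSin_sq_mem ht))]
  push_cast
  field_simp
  ring

lemma hasDerivAt_ratSin_mul_ps {d : ℕ → ℂ} (hd : PolyBdd d) {t : ℝ}
    (ht : t ∈ Set.Ioo (0 : ℝ) 1) :
    HasDerivAt (fun t => ratSin t * ps d (ratSin t ^ 2))
      ((angDeriv t * ratCos t : ℝ) * ps (fun n => (2 * (n : ℂ) + 1) * d n) (ratSin t ^ 2)) t := by
  refine ((hasDerivAt_ratSin t).ofReal_comp.mul (hasDerivAt_ps_sq_log hd ht)).congr_deriv ?_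
  have hs : (ratSin t : ℂ) ≠ 0 := by exact_mod_cast (ratSin_pos ht).ne'
  have : ps (fun n => (2 * (n : ℂ) + 1) * d n) (ratSin t ^ 2)
      = ps (fun n => 2 * ((n : ℂ) * d n)) (ratSin t ^ 2) + ps d (ratSin t ^ 2) := by
    rw [← ps_add (hd.natMul.const_mul 2) hd (abs_lt_one_of_mem (ratSin_sq_mem ht))]
    congr 1
    ext n
    ring
  rw [this]
  push_cast
  field_simp
  ring

lemma tendsto_ps_sq_zero {d : ℕ → ℂ} (hd : PolyBdd d) :
    Tendsto (fun t => ps d (ratSin t ^ 2)) (𝓝[>] 0) (𝓝 (d 0)) := by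
  refine (tendsto_ps_zero hd).comp (tendsto_nhdsWithin_iff.mpr ⟨?_, ?_⟩)
  · simpa using tendsto_ratSin_zero.pow 2
  · filter_upwards [Ioo_mem_nhdsGT (zero_lt_one (α := ℝ))] with t ht using (ratSin_sq_mem ht).1

lemma tendsto_ratSin_mul_ps_zero {d : ℕ → ℂ} (hd : PolyBdd d) :
    Tendsto (fun t => ratSin t * ps d (ratSin t ^ 2)) (𝓝[>] 0) (𝓝 0) := by
  have h : Tendsto (fun t => (ratSin t : ℂ)) (𝓝[>] 0) (𝓝 ((0 : ℝ) : ℂ)) :=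
    (Complex.continuous_ofReal.tendsto 0).comp tendsto_ratSin_zero
  simpa using h.mul (tendsto_ps_sq_zero hd)

lemma tendsto_ps_sq_one {e : ℕ → ℂ} (he : Summable e) :
    Tendsto (fun t => ps e (ratSin t ^ 2)) (𝓝[<] 1) (𝓝 (∑' n, e n)) := by
  have h := tendsto_map'_iff.mp
    (Complex.tendsto_tsum_powerSeries_nhdsWithin_lt he.hasSum.tendsto_sum_nat)
  refine h.comp (tendsto_nhdsWithin_iff.mpr ⟨?_, ?_⟩)
  · simpa using tendsto_ratSin_one.pow 2
  · filter_upwards [Ioo_mem_nhdsLT (zero_lt_one (α := ℝ))] with t ht using (ratSin_sq_mem ht).2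

/-- The class of functions is stable under two successive integrations against `dθ`. -/
lemma InIterSpan.of_hasDerivAt_ang_ang {w : ℕ} {U V h : ℝ → ℂ} (hh : InIterSpan 4 w h)
    (hV : ∀ t ∈ Set.Ioo (0 : ℝ) 1, HasDerivAt V (angDeriv t * U t) t)
    (hU : ∀ t ∈ Set.Ioo (0 : ℝ) 1, HasDerivAt U (angDeriv t * h t) t)
    (hV0 : Tendsto V (𝓝[>] 0) (𝓝 0)) (hU0 : Tendsto U (𝓝[>] 0) (𝓝 0)) :
    InIterSpan 4 (w + 2) V := by
  obtain ⟨φ, hφ, hφt⟩ := exists_angForm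
  have hφ' := unitForms_le_allForms 4 hφ
  have hU' : InIterSpan 4 (w + 1) fun t => Complex.I * U t := by
    refine (HasIterPrimitive.form_mul hφ' hh).inIterSpan (fun t ht => ?_)
      (by simpa using hU0.const_mul Complex.I)
    refine ((hU t ht).const_mul Complex.I).congr_deriv ?_
    rw [hφt t ht]
    ring
  have hV' := (HasIterPrimitive.form_mul hφ' hU').ratCast_mul (-1)
  refine hV'.inIterSpan (fun t ht => (hV t ht).congr_deriv ?_) hV0
  rw [hφt t ht]
  push_cast
  linear_combination ((angDeriv t : ℂ) * U t) * Complex.I_sq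

/-! ### Tail sums -/

/-- The tail `∑_{n ≥ j} e n` of a series. -/
noncomputable def tailSum (e : ℕ → ℂ) (j : ℕ) : ℂ := ∑' n, e (n + j)

lemma tailSum_zero (e : ℕ → ℂ) : tailSum e 0 = ∑' n, e n := rfl

lemma tailSum_eq_add {e : ℕ → ℂ} (he : Summable fun n => ‖e n‖) (j : ℕ) :
    tailSum e j = e j + tailSum e (j + 1) := by
  have h : Summable fun n => e (n + j) := (summable_nat_add_iff j).mpr he.of_norm
  rw [tailSum, h.tsum_eq_zero_add, tailSum, zero_add]
  simp only [add_assoc, add_comm 1 j]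

lemma norm_tailSum_le {e : ℕ → ℂ} (he : Summable fun n => ‖e n‖) (j : ℕ) :
    ‖tailSum e j‖ ≤ ∑' n, ‖e n‖ := by
  have h : Summable fun n => ‖e (n + j)‖ := (summable_nat_add_iff j).mpr he
  calc ‖tailSum e j‖ ≤ ∑' n, ‖e (n + j)‖ := norm_tsum_le_tsum_norm h
    _ ≤ ∑' n, ‖e n‖ := by
      rw [← he.sum_add_tsum_nat_add j]
      exact le_add_of_nonneg_left (Finset.sum_nonneg fun n _ => norm_nonneg _)

lemma polyBdd_of_summable {e : ℕ → ℂ} (he : Summable fun n => ‖e n‖) : PolyBdd e :=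
  PolyBdd.of_norm_le (∑' n, ‖e n‖) fun n => he.le_tsum n fun _ _ => norm_nonneg _

lemma one_le_norm_odd (j : ℕ) : 1 ≤ ‖2 * (j : ℂ) + 1‖ := by
  have h := Complex.norm_natCast (2 * j + 1)
  push_cast at h
  rw [h]
  linarith [(Nat.cast_nonneg j : (0 : ℝ) ≤ j)]

lemma odd_ne_zero (j : ℕ) : 2 * (j : ℂ) + 1 ≠ 0 := by
  exact_mod_cast (2 * j).succ_ne_zero

lemma PolyBdd.div_odd_pow {c : ℕ → ℂ} (h : PolyBdd c) (k : ℕ) :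
    PolyBdd fun j => c j / (2 * (j : ℂ) + 1) ^ k :=
  h.mono fun j => by
    rw [norm_div, norm_pow]
    exact div_le_self (norm_nonneg _) (one_le_pow₀ (one_le_norm_odd j))

lemma polyBdd_tailSum {e : ℕ → ℂ} (he : Summable fun n => ‖e n‖) :
    PolyBdd fun j => tailSum e (j + 1) :=
  PolyBdd.of_norm_le _ fun j => norm_tailSum_le he (j + 1)

lemma one_sub_mul_ps_tailSum {e : ℕ → ℂ} (he : Summable fun n => ‖e n‖) {s : ℝ} (hs : |s| < 1) :
    (1 - (s : ℂ)) * ps (fun j => tailSum e (j + 1)) s = (∑' n, e n) - ps e s := by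
  have hb := polyBdd_tailSum he
  have h1 := ps_eq_add hb hs
  have h2 := ps_eq_add (polyBdd_of_summable he) hs
  have h3 : ps (fun j => tailSum e (j + 1)) s
      = ps (fun n => e (n + 1)) s + ps (fun j => tailSum e (j + 1 + 1)) s := by
    rw [← ps_add (polyBdd_of_summable he).shift hb.shift hs]
    congr 1
    ext n
    exact tailSum_eq_add he (n + 1)
  have h4 := tailSum_eq_add he 0
  rw [tailSum_zero] at h4
  linear_combination h1 + h2 - s * h3 - h4

/-- Interchange of the order of summation: `∑ₙ eₙ ∑_{j < n} b_j = ∑ⱼ b_j ∑_{n > j} eₙ`. -/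
lemma summable_and_tsum_tailSum_mul {e : ℕ → ℂ} {b : ℕ → ℝ} (hb : ∀ j, 0 ≤ b j)
    (he : Summable fun n => ‖e n‖ * ∑ j ∈ Finset.range n, b j) :
    (Summable fun j => ‖tailSum e (j + 1)‖ * b j) ∧
      ∑' j, tailSum e (j + 1) * b j = ∑' n, e n * ((∑ j ∈ Finset.range n, b j : ℝ) : ℂ) := by
  set f : ℕ × ℕ → ℂ := fun p => e (p.2 + (p.1 + 1)) * b p.1 with hf
  have hanti : ∀ n : ℕ, ∀ p ∈ Finset.HasAntidiagonal.antidiagonal n,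
      p.2 + (p.1 + 1) = n + 1 := fun n p hp => by
    have := Finset.HasAntidiagonal.mem_antidiagonal.mp hp
    omega
  have hsumb : ∀ n : ℕ, ∑ p ∈ Finset.HasAntidiagonal.antidiagonal n, b p.1
      = ∑ j ∈ Finset.range (n + 1), b j := fun n => by
    rw [Finset.Nat.sum_antidiagonal_eq_sum_range_succ_mk]
  have hnorm : ∀ p, ‖f p‖ = ‖e (p.2 + (p.1 + 1))‖ * b p.1 := fun p => by
    rw [hf]
    simp only [norm_mul, Complex.norm_real, Real.norm_eq_abs, abs_of_nonneg (hb _)]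
  have hF : Summable fun p => ‖f p‖ := by
    rw [← Finset.HasAntidiagonal.sigmaAntidiagonalEquivProd.summable_iff]
    refine (summable_sigma_of_nonneg fun _ => norm_nonneg _).mpr ?_
    refine ⟨fun n => Summable.of_finite, ?_⟩
    refine ((summable_nat_add_iff 1).mpr he).congr fun n => ?_
    rw [tsum_fintype]
    simp only [Finset.HasAntidiagonal.sigmaAntidiagonalEquivProd_apply]
    rw [Finset.sum_coe_sort (Finset.HasAntidiagonal.antidiagonal n) (fun p => ‖f p‖), ← hsumb,
      Finset.mul_sum]
    refine Finset.sum_congr rfl fun p hp => ?_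
    rw [hnorm, hanti n p hp]
  constructor
  · have h1 := (summable_prod_of_nonneg fun _ => norm_nonneg _).mp hF
    refine Summable.of_nonneg_of_le (fun j => mul_nonneg (norm_nonneg _) (hb j)) (fun j => ?_) h1.2
    have h2 : ‖∑' m, f (j, m)‖ ≤ ∑' m, ‖f (j, m)‖ := norm_tsum_le_tsum_norm (h1.1 j)
    refine le_of_eq_of_le ?_ h2
    simp only [hf]
    rw [tsum_mul_right, norm_mul, Complex.norm_real, Real.norm_eq_abs, abs_of_nonneg (hb j)]
    rfl
  · have h1 : ∑' p, f p = ∑' j, tailSum e (j + 1) * b j := by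
      rw [hF.of_norm.tsum_prod]
      refine tsum_congr fun j => ?_
      simp only [hf]
      rw [tsum_mul_right]
      rfl
    have h2 := (Finset.HasAntidiagonal.sigmaAntidiagonalEquivProd.summable_iff.mpr
      hF.of_norm).tsum_sigma
    rw [← h1, ← Finset.HasAntidiagonal.sigmaAntidiagonalEquivProd.tsum_eq f]
    refine h2.trans ?_
    have hs : Summable fun n => e n * ((∑ j ∈ Finset.range n, b j : ℝ) : ℂ) := by
      refine Summable.of_norm (he.congr fun n => ?_)
      rw [norm_mul, Complex.norm_real, Real.norm_eq_abs,
        abs_of_nonneg (Finset.sum_nonneg fun j _ => hb j)]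
    rw [hs.tsum_eq_zero_add, Finset.range_zero, Finset.sum_empty, Complex.ofReal_zero, mul_zero,
      zero_add]
    refine tsum_congr fun n => ?_
    rw [tsum_fintype]
    simp only [Function.comp_apply, Finset.HasAntidiagonal.sigmaAntidiagonalEquivProd_apply]
    rw [Finset.sum_coe_sort (Finset.HasAntidiagonal.antidiagonal n) f, ← hsumb,
      Complex.ofReal_sum, Finset.mul_sum]
    refine Finset.sum_congr rfl fun p hp => ?_
    rw [hf]
    simp only [hanti n p hp]

/-! ### Summation against the star sums -/

/-- With `x = sin θ` and `g = ∑ e n * x ^ (2 n)`, one of the functions `g`, `x * g`, `g / x` is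
in the span of iterated integrals of weight `w`. The three cases account for the parity of the
denominators. -/
def IsRepresented (w : ℕ) (e : ℕ → ℂ) : Prop :=
  ∃ F, InIterSpan 4 w F ∧
    ((∀ t ∈ Set.Ioo (0 : ℝ) 1, F t = ps e (ratSin t ^ 2)) ∨
      (∀ t ∈ Set.Ioo (0 : ℝ) 1, F t = ratSin t * ps e (ratSin t ^ 2)) ∨
      (∀ t ∈ Set.Ioo (0 : ℝ) 1, ratSin t * F t = ps e (ratSin t ^ 2)))

lemma IsRepresented.tsum_mem {w : ℕ} {e : ℕ → ℂ} (h : IsRepresented w e) (he : Summable e) :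
    ∑' n, e n ∈ CMZV 4 w := by
  obtain ⟨F, hF, hFe⟩ := h
  refine hF.limit_mem ?_
  have h1 := tendsto_ps_sq_one he
  have h2 : Tendsto (fun t => (ratSin t : ℂ)) (𝓝[<] 1) (𝓝 1) := by
    have := (Complex.continuous_ofReal.tendsto 1).comp tendsto_ratSin_one
    rwa [Complex.ofReal_one] at this
  have hmem : ∀ᶠ t in 𝓝[<] (1 : ℝ), t ∈ Set.Ioo (0 : ℝ) 1 := Ioo_mem_nhdsLT zero_lt_one
  rcases hFe with h | h | h
  · refine h1.congr' ?_
    filter_upwards [hmem] with t ht using (h t ht).symm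
  · have h3 := h2.mul h1
    rw [one_mul] at h3
    refine h3.congr' ?_
    filter_upwards [hmem] with t ht using (h t ht).symm
  · have h3 := h1.div h2 one_ne_zero
    rw [div_one] at h3
    refine h3.congr' ?_
    filter_upwards [hmem] with t ht
    have hs : (ratSin t : ℂ) ≠ 0 := by exact_mod_cast (ratSin_pos ht).ne'
    rw [Pi.div_apply, ← h t ht]
    exact mul_div_cancel_left₀ _ hs

/-- Taking tail sums amounts to `g ↦ (g(1) - g) / (1 - x ^ 2)`, and dividing by a power of `2 j + 1`
to integrations against `dx / x`. -/
lemma IsRepresented.tail {w : ℕ} {e : ℕ → ℂ} (h : IsRepresented w e)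
    (he : Summable fun n => ‖e n‖) (k : ℕ) :
    InIterSpan 4 (w + (k + 1)) fun t => ratSin t *
      ps (fun j => tailSum e (j + 1) / (2 * (j : ℂ) + 1) ^ (k + 1)) (ratSin t ^ 2) := by
  have hT := polyBdd_tailSum he
  induction k with
  | zero =>
    have hκ := h.tsum_mem he.of_norm
    obtain ⟨F, hF, hFe⟩ := h
    obtain ⟨φ₁, hφ₁, h₁⟩ := exists_oddForm
    obtain ⟨φ₂, hφ₂, h₂⟩ := exists_evenForm
    obtain ⟨φ₀, hφ₀, h₀⟩ := exists_logForm
    have hψ : ∃ ψ ∈ allForms 4, ∀ t ∈ Set.Ioo (0 : ℝ) 1,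
        ψ t * F t = (angDeriv t / ratCos t : ℝ) * ps e (ratSin t ^ 2) := by
      rcases hFe with h | h | h
      · exact ⟨φ₁, unitForms_le_allForms 4 hφ₁, fun t ht => by rw [h t ht, h₁ t ht]⟩
      · refine ⟨φ₀ + φ₂, add_mem hφ₀ (unitForms_le_allForms 4 hφ₂), fun t ht => ?_⟩
        have hs : (ratSin t : ℂ) ≠ 0 := by exact_mod_cast (ratSin_pos ht).ne'
        have hc : (ratCos t : ℂ) ≠ 0 := by exact_mod_cast (ratCos_pos ht).ne'
        have hsc : (ratSin t : ℂ) ^ 2 + (ratCos t : ℂ) ^ 2 = 1 := by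
          exact_mod_cast ratSin_sq_add_ratCos_sq t
        rw [Pi.add_apply, h t ht, h₀ t ht, h₂ t ht]
        push_cast
        field_simp
        linear_combination (angDeriv t : ℂ) * ps e (ratSin t ^ 2) * hsc
      · refine ⟨φ₂, unitForms_le_allForms 4 hφ₂, fun t ht => ?_⟩
        rw [h₂ t ht, ← h t ht]
        push_cast
        ring
    obtain ⟨ψ, hψ, hψF⟩ := hψ
    have hprim := (HasIterPrimitive.form_mul_const hφ₁ hκ).add
      ((HasIterPrimitive.form_mul hψ hF).ratCast_mul (-1))
    refine hprim.inIterSpan (fun t ht => ?_) (tendsto_ratSin_mul_ps_zero (hT.div_odd_pow _))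
    refine (hasDerivAt_ratSin_mul_ps (hT.div_odd_pow _) ht).congr_deriv ?_
    rw [hψF t ht, h₁ t ht]
    have htail := one_sub_mul_ps_tailSum he (abs_lt_one_of_mem (ratSin_sq_mem ht))
    have hc : (ratCos t : ℂ) ≠ 0 := by exact_mod_cast (ratCos_pos ht).ne'
    have hsc : (ratSin t : ℂ) ^ 2 + (ratCos t : ℂ) ^ 2 = 1 := by
      exact_mod_cast ratSin_sq_add_ratCos_sq t
    have hcoef : (fun n : ℕ =>
          (2 * (n : ℂ) + 1) * (tailSum e (n + 1) / (2 * (n : ℂ) + 1) ^ (0 + 1)))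
        = fun n => tailSum e (n + 1) := by
      ext n
      rw [zero_add, pow_one, mul_div_cancel₀ _ (odd_ne_zero n)]
    rw [hcoef]
    push_cast at htail ⊢
    field_simp
    linear_combination (angDeriv t : ℂ) * htail
      + (angDeriv t : ℂ) * ps (fun j => tailSum e (j + 1)) (ratSin t ^ 2) * hsc
  | succ k ih =>
    obtain ⟨φ₀, hφ₀, h₀⟩ := exists_logForm
    have hprim := HasIterPrimitive.form_mul hφ₀ ih
    refine hprim.inIterSpan (fun t ht => ?_) (tendsto_ratSin_mul_ps_zero (hT.div_odd_pow _))
    refine (hasDerivAt_ratSin_mul_ps (hT.div_odd_pow _) ht).congr_deriv ?_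
    have hs : (ratSin t : ℂ) ≠ 0 := by exact_mod_cast (ratSin_pos ht).ne'
    have hcoef : (fun n : ℕ =>
          (2 * (n : ℂ) + 1) * (tailSum e (n + 1) / (2 * (n : ℂ) + 1) ^ (k + 1 + 1)))
        = fun n : ℕ => tailSum e (n + 1) / (2 * (n : ℂ) + 1) ^ (k + 1) := by
      ext n
      have := odd_ne_zero n
      rw [pow_succ _ (k + 1)]
      field_simp
    rw [hcoef, h₀ t ht]
    push_cast
    field_simp

lemma multTHarmonicStar_nonneg (k : List ℕ) (n : ℕ) : 0 ≤ multTHarmonicStar k n := by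
  induction k generalizing n with
  | nil => simp [multTHarmonicStar]
  | cons a k ih =>
    rw [multTHarmonicStar]
    exact Finset.sum_nonneg fun j _ => mul_nonneg (by positivity) (ih _)

lemma one_le_multTHarmonicStar (k : List ℕ) (n : ℕ) : 1 ≤ multTHarmonicStar k (n + 1) := by
  induction k generalizing n with
  | nil => simp [multTHarmonicStar]
  | cons a k ih =>
    rw [multTHarmonicStar, Finset.sum_range_succ']
    have h1 := ih 0
    have h2 : 0 ≤ ∑ j ∈ Finset.range n, 1 / (2 * ((j + 1 : ℕ) : ℝ) + 1) ^ a
        * multTHarmonicStar k (j + 1 + 1) :=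
      Finset.sum_nonneg fun j _ => mul_nonneg (by positivity) (multTHarmonicStar_nonneg _ _)
    simpa using le_add_of_nonneg_of_le h2 h1

/-- The series `∑ e n * t⋆ₙ(k)` is a colored multiple zeta value as soon as the generating function
of `e` is an iterated integral: the entries of `k` are processed one at a time by tail sums. -/
theorem IsRepresented.tsum_mul_star_mem (k : List ℕ) (hk : ∀ a ∈ k, 1 ≤ a) :
    ∀ (w : ℕ) (e : ℕ → ℂ), IsRepresented w e → (Summable fun n => ‖e n‖) →
      (Summable fun n => ‖e n‖ * multTHarmonicStar k n) →
      ∑' n, e n * (multTHarmonicStar k n : ℂ) ∈ CMZV 4 (w + k.sum) := by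
  induction k with
  | nil =>
    intro w e h he _
    simpa [multTHarmonicStar] using h.tsum_mem he.of_norm
  | cons a k ih =>
    intro w e h he hek
    obtain ⟨a, rfl⟩ : ∃ a', a = a' + 1 := ⟨a - 1, by have := hk a (by simp); omega⟩
    -- the tails of `e`, divided by a power of `2 j - 1`, are the coefficients `e'` for the rest
    set b : ℕ → ℝ := fun j => 1 / (2 * (j : ℝ) + 1) ^ (a + 1) * multTHarmonicStar k (j + 1) with hb
    have hb0 : ∀ j, 0 ≤ b j := fun j => mul_nonneg (by positivity) (multTHarmonicStar_nonneg _ _)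
    obtain ⟨hs, hsum⟩ := summable_and_tsum_tailSum_mul hb0 hek
    set d : ℕ → ℂ := fun j => tailSum e (j + 1) / (2 * (j : ℂ) + 1) ^ (a + 1) with hd
    set e' : ℕ → ℂ := fun n => if n = 0 then 0 else d (n - 1) with he'
    have he0 : e' 0 = 0 := rfl
    have hes : ∀ j, e' (j + 1) = d j := fun j => by simp [he']
    have hnd : ∀ j, ‖d j‖ = ‖tailSum e (j + 1)‖ * (1 / (2 * (j : ℝ) + 1) ^ (a + 1)) := fun j => by
      have h := Complex.norm_natCast (2 * j + 1)
      push_cast at h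
      rw [hd]
      simp only [norm_div, norm_pow, h]
      ring
    have hsd : Summable fun j => ‖d j‖ * multTHarmonicStar k (j + 1) :=
      hs.congr fun j => by rw [hnd, hb]; ring
    have hsd1 : Summable fun j => ‖d j‖ :=
      Summable.of_nonneg_of_le (fun _ => norm_nonneg _)
        (fun j => le_mul_of_one_le_right (norm_nonneg _) (one_le_multTHarmonicStar k j)) hsd
    have hse : Summable fun n => ‖e' n‖ := by
      rw [← summable_nat_add_iff 1]
      simpa only [hes] using hsd1
    have hsek : Summable fun n => ‖e' n‖ * multTHarmonicStar k n := by
      rw [← summable_nat_add_iff 1]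
      simpa only [hes] using hsd
    have hrep : IsRepresented (w + (a + 1)) e' := by
      refine ⟨_, h.tail he a, Or.inr (Or.inr fun t ht => ?_)⟩
      rw [ps_eq_add (polyBdd_of_summable hse) (abs_lt_one_of_mem (ratSin_sq_mem ht)), he0]
      simp only [hes]
      push_cast
      ring
    have key := ih (fun x hx => hk x (by simp [hx])) _ e' hrep hse hsek
    have hval : ∑' n, e' n * (multTHarmonicStar k n : ℂ)
        = ∑' n, e n * (multTHarmonicStar ((a + 1) :: k) n : ℂ) := by
      have hs' : Summable fun n => e' n * (multTHarmonicStar k n : ℂ) := by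
        refine Summable.of_norm (hsek.congr fun n => ?_)
        rw [norm_mul, Complex.norm_real, Real.norm_eq_abs,
          abs_of_nonneg (multTHarmonicStar_nonneg _ _)]
      rw [hs'.tsum_eq_zero_add, he0, zero_mul, zero_add]
      refine Eq.trans (tsum_congr fun j => ?_) hsum
      rw [hes, hd, hb]
      push_cast
      ring
    rw [hval] at key
    rwa [List.sum_cons, ← add_assoc]

/-! ### Powers of the arcsine -/

/-- For `y' = ps c` as a function of `x = sin θ`, the right-hand side is
`(1 - x ^ 2) * y'' - x * y'`, which is the second derivative of `y` with respect to `θ`. -/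
lemma hasDerivAt_ratCos_mul_ps {c : ℕ → ℂ} (hc : PolyBdd c) {t : ℝ}
    (ht : t ∈ Set.Ioo (0 : ℝ) 1) :
    HasDerivAt (fun t => ratCos t * ps c (ratSin t ^ 2))
      (angDeriv t * (ratSin t *
        ps (fun n => 2 * (((n : ℂ) + 1) * c (n + 1)) + -1 * ((2 * (n : ℂ) + 1) * c n))
          (ratSin t ^ 2))) t := by
  have hs := abs_lt_one_of_mem (ratSin_sq_mem ht)
  refine ((hasDerivAt_ratCos t).ofReal_comp.mul (hasDerivAt_ps_sq hc ht)).congr_deriv ?_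
  have h1 := ps_eq_add hc.natMul hs
  have h2 : (fun n : ℕ => (2 * (n : ℂ) + 1) * c n) = fun n : ℕ => 2 * ((n : ℂ) * c n) + c n := by
    ext n
    ring
  have h3 : PolyBdd fun n => (2 * (n : ℂ) + 1) * c n := by
    rw [h2]
    exact (hc.natMul.const_mul 2).add hc
  have h4 : (ratSin t : ℂ) ^ 2 + (ratCos t : ℂ) ^ 2 = 1 := by
    exact_mod_cast ratSin_sq_add_ratCos_sq t
  rw [ps_add (hc.deriv.const_mul 2) (h3.const_mul (-1)) hs, ps_const_mul, ps_const_mul, h2,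
    ps_add (hc.natMul.const_mul 2) hc hs, ps_const_mul]
  push_cast at h1 ⊢
  linear_combination (2 * angDeriv t * ratSin t : ℂ) * h1
    + (2 * angDeriv t * ratSin t * ps (fun n => ((n : ℂ) + 1) * c (n + 1)) (ratSin t ^ 2) : ℂ) * h4

/-- For `y = ps d` as a function of `x ^ 2`, `x = sin θ`, this is half of
`d ^ 2 y / dθ ^ 2 = (1 - x ^ 2) * y'' - x * y'`. -/
lemma hasDerivAt_ratCos_mul_ratSin_mul_ps {d : ℕ → ℂ} (hd : PolyBdd d) {t : ℝ}
    (ht : t ∈ Set.Ioo (0 : ℝ) 1) :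
    HasDerivAt (fun t => ratCos t *
        (ratSin t * ps (fun n => ((n : ℂ) + 1) * d (n + 1)) (ratSin t ^ 2)))
      (angDeriv t * ps (fun n => (2 * (n : ℂ) + 1) * (((n : ℂ) + 1) * d (n + 1))
        + -2 * ((n : ℂ) * ((n : ℂ) * d n))) (ratSin t ^ 2)) t := by
  have hs := abs_lt_one_of_mem (ratSin_sq_mem ht)
  set c : ℕ → ℂ := fun n => ((n : ℂ) + 1) * d (n + 1) with hcdef
  have hc : PolyBdd c := hd.deriv
  refine ((hasDerivAt_ratCos t).ofReal_comp.mul (hasDerivAt_ratSin_mul_ps hc ht)).congr_deriv ?_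
  have h1 := ps_eq_add hd.natMul.natMul hs
  have h2 : (fun n : ℕ => (2 * (n : ℂ) + 1) * c n) = fun n : ℕ => 2 * ((n : ℂ) * c n) + c n := by
    ext n
    ring
  have h3 : PolyBdd fun n => (2 * (n : ℂ) + 1) * c n := by
    rw [h2]
    exact (hc.natMul.const_mul 2).add hc
  have h4 : (ratSin t : ℂ) ^ 2 + (ratCos t : ℂ) ^ 2 = 1 := by
    exact_mod_cast ratSin_sq_add_ratCos_sq t
  have h5 : (fun n : ℕ => ((n + 1 : ℕ) : ℂ) * (((n + 1 : ℕ) : ℂ) * d (n + 1)))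
      = fun n : ℕ => (n : ℂ) * c n + c n := by
    ext n
    rw [hcdef]
    push_cast
    ring
  rw [h5, ps_add hc.natMul hc hs] at h1
  rw [ps_add h3 (hd.natMul.natMul.const_mul (-2)) hs, ps_const_mul, h1, h2,
    ps_add (hc.natMul.const_mul 2) hc hs, ps_const_mul]
  push_cast
  linear_combination (angDeriv t * (2 * ps (fun n => (n : ℂ) * c n) (ratSin t ^ 2)
    + ps c (ratSin t ^ 2)) : ℂ) * h4

/-- The harmonic numbers as real numbers. -/
noncomputable def realHarmonic (n : ℕ) : ℝ := ∑ j ∈ Finset.range n, 1 / ((j : ℝ) + 1)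

lemma realHarmonic_mono : Monotone realHarmonic := fun m n h =>
  Finset.sum_le_sum_of_subset_of_nonneg (Finset.range_mono h) fun j _ _ => by positivity

lemma realHarmonic_nonneg (n : ℕ) : 0 ≤ realHarmonic n :=
  Finset.sum_nonneg fun j _ => by positivity

lemma realHarmonic_le (n : ℕ) : realHarmonic n ≤ n := by
  have : realHarmonic n ≤ ∑ j ∈ Finset.range n, (1 : ℝ) :=
    Finset.sum_le_sum fun j _ => by
      rw [div_le_one (by positivity)]
      linarith [(Nat.cast_nonneg j : (0 : ℝ) ≤ j)]
  simpa using this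

lemma realHarmonic_le_log (n : ℕ) : realHarmonic n ≤ 1 + Real.log n := by
  refine le_of_eq_of_le ?_ (harmonic_le_one_add_log n)
  rw [realHarmonic, harmonic]
  push_cast
  simp

lemma sum_le_realHarmonic_pow {c S : ℕ → ℝ} {n r : ℕ}
    (hc : ∀ j, 0 ≤ c j ∧ c j ≤ 1 / ((j : ℝ) + 1))
    (hS : ∀ j < n, 0 ≤ S j ∧ S j ≤ realHarmonic n ^ r) :
    0 ≤ ∑ j ∈ Finset.range n, c j * S j ∧
      ∑ j ∈ Finset.range n, c j * S j ≤ realHarmonic n ^ (r + 1) := by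
  constructor
  · exact Finset.sum_nonneg fun j hj => mul_nonneg (hc j).1 (hS j (Finset.mem_range.mp hj)).1
  · rw [pow_succ', realHarmonic, Finset.sum_mul]
    refine Finset.sum_le_sum fun j hj => ?_
    have hj := hS j (Finset.mem_range.mp hj)
    exact mul_le_mul (hc j).2 hj.2 hj.1 (by positivity)

lemma one_div_odd_pow_le {a : ℕ} (ha : 1 ≤ a) (j : ℕ) :
    0 ≤ 1 / (2 * (j : ℝ) + 1) ^ a ∧ 1 / (2 * (j : ℝ) + 1) ^ a ≤ 1 / ((j : ℝ) + 1) := by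
  have hj : (0 : ℝ) ≤ j := Nat.cast_nonneg j
  refine ⟨by positivity, one_div_le_one_div_of_le (by positivity) ?_⟩
  calc (j : ℝ) + 1 ≤ 2 * j + 1 := by linarith
    _ ≤ _ := le_self_pow₀ (by linarith) (by omega)

lemma one_div_pow_le {a : ℕ} (ha : 1 ≤ a) (j : ℕ) :
    0 ≤ 1 / ((j : ℝ) + 1) ^ a ∧ 1 / ((j : ℝ) + 1) ^ a ≤ 1 / ((j : ℝ) + 1) := by
  have hj : (0 : ℝ) ≤ j := Nat.cast_nonneg j
  exact ⟨by positivity, one_div_le_one_div_of_le (by positivity)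
    (le_self_pow₀ (by linarith) (by omega))⟩

lemma multHarmonic_bounds {k : List ℕ} (hk : ∀ a ∈ k, 1 ≤ a) (n : ℕ) :
    0 ≤ multHarmonic k n ∧ multHarmonic k n ≤ realHarmonic n ^ k.length := by
  induction k generalizing n with
  | nil => simp [multHarmonic]
  | cons a k ih =>
    have ih := ih fun b hb => hk b (by simp [hb])
    exact sum_le_realHarmonic_pow (one_div_pow_le (hk a (by simp))) fun j hj =>
      ⟨(ih j).1, (ih j).2.trans (pow_le_pow_left₀ (realHarmonic_nonneg _)
        (realHarmonic_mono hj.le) _)⟩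

lemma multTHarmonic_bounds {k : List ℕ} (hk : ∀ a ∈ k, 1 ≤ a) (n : ℕ) :
    0 ≤ multTHarmonic k n ∧ multTHarmonic k n ≤ realHarmonic n ^ k.length := by
  induction k generalizing n with
  | nil => simp [multTHarmonic]
  | cons a k ih =>
    have ih := ih fun b hb => hk b (by simp [hb])
    exact sum_le_realHarmonic_pow (one_div_odd_pow_le (hk a (by simp))) fun j hj =>
      ⟨(ih j).1, (ih j).2.trans (pow_le_pow_left₀ (realHarmonic_nonneg _)
        (realHarmonic_mono hj.le) _)⟩

lemma multTHarmonicStar_le {k : List ℕ} (hk : ∀ a ∈ k, 1 ≤ a) (n : ℕ) :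
    multTHarmonicStar k n ≤ realHarmonic n ^ k.length := by
  induction k generalizing n with
  | nil => simp [multTHarmonicStar]
  | cons a k ih =>
    have ih := ih fun b hb => hk b (by simp [hb])
    exact (sum_le_realHarmonic_pow (S := fun j => multTHarmonicStar k (j + 1))
      (one_div_odd_pow_le (hk a (by simp))) fun j hj =>
      ⟨multTHarmonicStar_nonneg _ _, (ih (j + 1)).trans
        (pow_le_pow_left₀ (realHarmonic_nonneg _) (realHarmonic_mono hj) _)⟩).2

lemma one_le_of_mem_replicate_two {p a : ℕ} (h : a ∈ List.replicate p 2) : 1 ≤ a := by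
  rw [List.eq_of_mem_replicate h]
  norm_num

/-- The numbers `binom(2n, n) / 4 ^ n * t_n(2, …, 2)` with `p` entries `2`. -/
noncomputable def oddCoeff (p n : ℕ) : ℝ := cbin n * multTHarmonic (List.replicate p 2) n

/-- The numbers `4 ^ n * ζ_{n-1}(2, …, 2) / (binom(2n, n) * n ^ 2)` with `p` entries `2`; the value
at `n = 0` is `0`. -/
noncomputable def evenCoeff (p n : ℕ) : ℝ :=
  multHarmonic (List.replicate p 2) (n - 1) / (cbin n * (n : ℝ) ^ 2)

lemma evenCoeff_zero (p : ℕ) : evenCoeff p 0 = 0 := by simp [evenCoeff]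

lemma evenCoeff_succ (p n : ℕ) :
    evenCoeff p (n + 1)
      = multHarmonic (List.replicate p 2) n / (cbin (n + 1) * ((n : ℝ) + 1) ^ 2) := by
  rw [evenCoeff, Nat.add_sub_cancel]
  push_cast
  rfl

lemma one_div_cbin_le (n : ℕ) : 1 / cbin (n + 1) ≤ 2 * √((n : ℝ) + 1) := by
  have h := le_cbin_sq n
  have hc := cbin_pos (n + 1)
  rw [div_le_iff₀ hc]
  refine le_of_sq_le_sq ?_ (by positivity)
  rw [one_pow, mul_pow, mul_pow, Real.sq_sqrt (by positivity)]
  linarith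

lemma polyBdd_oddCoeff (p : ℕ) : PolyBdd fun n => (oddCoeff p n : ℂ) := by
  refine ⟨1, p, fun n => ?_⟩
  obtain ⟨h0, h1⟩ := multTHarmonic_bounds (fun a => one_le_of_mem_replicate_two (p := p)) n
  rw [List.length_replicate] at h1
  rw [Complex.norm_real, Real.norm_eq_abs, oddCoeff, abs_of_nonneg (mul_nonneg (cbin_pos n).le h0)]
  refine mul_le_mul (cbin_le_one n) (h1.trans ?_) h0 zero_le_one
  exact pow_le_pow_left₀ (realHarmonic_nonneg _) ((realHarmonic_le n).trans (by linarith)) _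

lemma polyBdd_evenCoeff (p : ℕ) : PolyBdd fun n => (evenCoeff p n : ℂ) := by
  refine ⟨2, p, fun n => ?_⟩
  cases n with
  | zero => simp [evenCoeff_zero]
  | succ n =>
    obtain ⟨h0, h1⟩ := multHarmonic_bounds (fun a => one_le_of_mem_replicate_two (p := p)) n
    rw [List.length_replicate] at h1
    have hc := cbin_pos (n + 1)
    have hn : (0 : ℝ) ≤ n := Nat.cast_nonneg n
    rw [Complex.norm_real, Real.norm_eq_abs, evenCoeff_succ, abs_of_nonneg (by positivity)]
    have h2 : √((n : ℝ) + 1) ≤ (n : ℝ) + 1 := Real.sqrt_le_iff.mpr ⟨by positivity, by nlinarith⟩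
    have h3 : 1 / (cbin (n + 1) * ((n : ℝ) + 1) ^ 2) ≤ 2 := by
      rw [← div_div, div_le_iff₀ (by positivity)]
      refine (one_div_cbin_le n).trans ?_
      nlinarith
    have h4 : multHarmonic (List.replicate p 2) n ≤ (((n + 1 : ℕ) : ℝ) + 1) ^ p := by
      refine h1.trans (pow_le_pow_left₀ (realHarmonic_nonneg _) ((realHarmonic_le n).trans ?_) _)
      push_cast
      linarith
    rw [div_eq_mul_one_div, mul_comm]
    exact mul_le_mul h3 h4 h0 zero_le_two

lemma two_mul_succ_mul_oddCoeff (p n : ℕ) :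
    2 * (((n : ℝ) + 1) * oddCoeff (p + 1) (n + 1)) - (2 * n + 1) * oddCoeff (p + 1) n
      = oddCoeff p n / (2 * n + 1) := by
  have h := cbin_succ n
  have hn : 2 * (n : ℝ) + 1 ≠ 0 := by positivity
  have hτ : multTHarmonic (List.replicate (p + 1) 2) (n + 1)
      = multTHarmonic (List.replicate (p + 1) 2) n
        + 1 / (2 * (n : ℝ) + 1) ^ 2 * multTHarmonic (List.replicate p 2) n := by
    rw [List.replicate_succ, multTHarmonic, multTHarmonic, Finset.sum_range_succ]
  unfold oddCoeff
  rw [hτ]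
  field_simp
  linear_combination ((2 * (n : ℝ) + 1) ^ 2 * multTHarmonic (List.replicate (p + 1) 2) n
    + multTHarmonic (List.replicate p 2) n) * h

lemma two_mul_succ_mul_oddCoeff_zero (n : ℕ) :
    2 * (((n : ℝ) + 1) * oddCoeff 0 (n + 1)) - (2 * n + 1) * oddCoeff 0 n = 0 := by
  have h := cbin_succ n
  simp only [oddCoeff, List.replicate_zero, multTHarmonic]
  linarith

/-- The function `∑ binom(2n, n) / 4 ^ n * t_n(2, …, 2) * x ^ (2 n + 1) / (2 n + 1)` is the power
`θ ^ (2 p + 1) / (2 p + 1)!` of the angle `θ = arcsin x`; each step of the induction integrates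
twice against `dθ`. -/
lemma inIterSpan_odd (p : ℕ) : InIterSpan 4 (2 * p + 1) fun t => Complex.I * (ratSin t *
    ps (fun n => (oddCoeff p n : ℂ) / (2 * (n : ℂ) + 1) ^ 1) (ratSin t ^ 2)) := by
  have hder : ∀ q, ∀ t ∈ Set.Ioo (0 : ℝ) 1, HasDerivAt (fun t => ratSin t *
      ps (fun n => (oddCoeff q n : ℂ) / (2 * (n : ℂ) + 1) ^ 1) (ratSin t ^ 2))
      (angDeriv t * (ratCos t * ps (fun n => (oddCoeff q n : ℂ)) (ratSin t ^ 2))) t := by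
    intro q t ht
    refine (hasDerivAt_ratSin_mul_ps ((polyBdd_oddCoeff q).div_odd_pow 1) ht).congr_deriv ?_
    have : (fun n : ℕ => (2 * (n : ℂ) + 1) * ((oddCoeff q n : ℂ) / (2 * (n : ℂ) + 1) ^ 1))
        = fun n => (oddCoeff q n : ℂ) := by
      ext n
      rw [pow_one, mul_div_cancel₀ _ (odd_ne_zero n)]
    rw [this]
    push_cast
    ring
  have hcos : Tendsto (fun t => (ratCos t : ℂ)) (𝓝[>] 0) (𝓝 1) := by
    have := (Complex.continuous_ofReal.tendsto 1).comp tendsto_ratCos_zero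
    rwa [Complex.ofReal_one] at this
  induction p with
  | zero =>
    -- this is `dθ / dθ = 1`, the central binomial series for `1 / cos θ`
    have hU : ∀ t ∈ Set.Ioo (0 : ℝ) 1,
        ratCos t * ps (fun n => (oddCoeff 0 n : ℂ)) (ratSin t ^ 2) = 1 := by
      refine eqOn_of_hasDerivAt (l := 1) (h := fun _ => 0)
        (F := fun t => ratCos t * ps (fun n => (oddCoeff 0 n : ℂ)) (ratSin t ^ 2))
        (G := fun _ => 1) (fun t ht => ?_)
        (fun t _ => hasDerivAt_const _ _) ?_ tendsto_const_nhds
      · refine (hasDerivAt_ratCos_mul_ps (polyBdd_oddCoeff 0) ht).congr_deriv ?_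
        have : (fun n : ℕ => 2 * (((n : ℂ) + 1) * (oddCoeff 0 (n + 1) : ℂ))
            + -1 * ((2 * (n : ℂ) + 1) * (oddCoeff 0 n : ℂ))) = fun n => 0 := by
          ext n
          have h : ((2 * (((n : ℝ) + 1) * oddCoeff 0 (n + 1)) - (2 * n + 1) * oddCoeff 0 n : ℝ) : ℂ)
              = 0 := by
            rw [two_mul_succ_mul_oddCoeff_zero, Complex.ofReal_zero]
          push_cast at h
          linear_combination h
        rw [this]
        simp [ps]
      · have h := hcos.mul (tendsto_ps_sq_zero (polyBdd_oddCoeff 0))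
        have h0 : oddCoeff 0 0 = 1 := by simp [oddCoeff, cbin_zero, multTHarmonic]
        rwa [h0, Complex.ofReal_one, one_mul] at h
    obtain ⟨φ, hφ, hφt⟩ := exists_angForm
    have hprim := HasIterPrimitive.form_mul_const hφ (one_mem_CMZV 4)
    refine hprim.inIterSpan (fun t ht => ?_) ?_
    · refine ((hder 0 t ht).const_mul Complex.I).congr_deriv ?_
      rw [hU t ht, hφt t ht]
      ring
    · simpa using (tendsto_ratSin_mul_ps_zero
        ((polyBdd_oddCoeff 0).div_odd_pow 1)).const_mul Complex.I
  | succ p ih =>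
    refine InIterSpan.of_hasDerivAt_ang_ang (w := 2 * p + 1) ih
      (U := fun t => Complex.I * (ratCos t * (ps (fun n => (oddCoeff (p + 1) n : ℂ))
        (ratSin t ^ 2)))) (fun t ht => ?_) (fun t ht => ?_) ?_ ?_
    · exact ((hder (p + 1) t ht).const_mul Complex.I).congr_deriv (by ring)
    · refine ((hasDerivAt_ratCos_mul_ps (polyBdd_oddCoeff (p + 1)) ht).const_mul
        Complex.I).congr_deriv ?_
      have : (fun n : ℕ => 2 * (((n : ℂ) + 1) * (oddCoeff (p + 1) (n + 1) : ℂ))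
          + -1 * ((2 * (n : ℂ) + 1) * (oddCoeff (p + 1) n : ℂ)))
          = fun n => (oddCoeff p n : ℂ) / (2 * (n : ℂ) + 1) ^ 1 := by
        ext n
        have h := congrArg (fun x : ℝ => (x : ℂ)) (two_mul_succ_mul_oddCoeff p n)
        push_cast at h
        rw [pow_one]
        linear_combination h
      rw [this]
      ring
    · simpa using (tendsto_ratSin_mul_ps_zero
        ((polyBdd_oddCoeff (p + 1)).div_odd_pow 1)).const_mul Complex.I
    · have h := (hcos.mul (tendsto_ps_sq_zero (polyBdd_oddCoeff (p + 1)))).const_mul Complex.I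
      have h0 : oddCoeff (p + 1) 0 = 0 := by
        rw [oddCoeff, List.replicate_succ, multTHarmonic]
        simp
      simpa [h0] using h

lemma inIterSpan_odd_pow (p m : ℕ) : InIterSpan 4 (2 * p + (m + 1)) fun t => Complex.I *
    (ratSin t * ps (fun n => (oddCoeff p n : ℂ) / (2 * (n : ℂ) + 1) ^ (m + 1))
      (ratSin t ^ 2)) := by
  induction m with
  | zero => exact inIterSpan_odd p
  | succ m ih =>
    obtain ⟨φ, hφ, hφt⟩ := exists_logForm
    have hb := (polyBdd_oddCoeff p).div_odd_pow (m + 1 + 1)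
    refine (HasIterPrimitive.form_mul hφ ih).inIterSpan (fun t ht => ?_)
      (by simpa using (tendsto_ratSin_mul_ps_zero hb).const_mul Complex.I)
    refine ((hasDerivAt_ratSin_mul_ps hb ht).const_mul Complex.I).congr_deriv ?_
    have hs : (ratSin t : ℂ) ≠ 0 := by exact_mod_cast (ratSin_pos ht).ne'
    have hcoef : (fun n : ℕ =>
          (2 * (n : ℂ) + 1) * ((oddCoeff p n : ℂ) / (2 * (n : ℂ) + 1) ^ (m + 1 + 1)))
        = fun n : ℕ => (oddCoeff p n : ℂ) / (2 * (n : ℂ) + 1) ^ (m + 1) := by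
      ext n
      have := odd_ne_zero n
      rw [pow_succ _ (m + 1)]
      field_simp
    rw [hcoef, hφt t ht]
    push_cast
    field_simp

lemma evenCoeff_rec (p n : ℕ) :
    (2 * (n : ℝ) + 1) * (((n : ℝ) + 1) * evenCoeff (p + 1) (n + 1))
      - 2 * (n * (n * evenCoeff (p + 1) n)) = 2 * evenCoeff p n := by
  have hc := (cbin_pos (n + 1)).ne'
  cases n with
  | zero => simp [evenCoeff_zero, evenCoeff_succ, List.replicate_succ, multHarmonic]
  | succ n =>
    have h := cbin_succ (n + 1)
    have hc' := (cbin_pos (n + 1)).ne'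
    have hn : (n : ℝ) + 1 ≠ 0 := by positivity
    have hn' : ((n + 1 : ℕ) : ℝ) + 1 ≠ 0 := by positivity
    have hn2 : 2 * ((n + 1 : ℕ) : ℝ) + 1 ≠ 0 := by positivity
    have hζ : multHarmonic (List.replicate (p + 1) 2) (n + 1)
        = multHarmonic (List.replicate (p + 1) 2) n
          + 1 / ((n : ℝ) + 1) ^ 2 * multHarmonic (List.replicate p 2) n := by
      rw [List.replicate_succ, multHarmonic, multHarmonic, Finset.sum_range_succ]
    have hc2 : cbin (n + 1 + 1) = (2 * ((n + 1 : ℕ) : ℝ) + 1) * cbin (n + 1)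
        / (2 * (((n + 1 : ℕ) : ℝ) + 1)) := by
      field_simp
      linarith
    rw [evenCoeff_succ, evenCoeff_succ, evenCoeff_succ, hζ, hc2]
    push_cast at hn' hn2 ⊢
    field_simp
    ring

lemma evenCoeff_rec_zero (n : ℕ) :
    (2 * (n : ℝ) + 1) * (((n : ℝ) + 1) * evenCoeff 0 (n + 1))
      - 2 * (n * (n * evenCoeff 0 n)) = if n = 0 then 2 else 0 := by
  cases n with
  | zero => norm_num [evenCoeff_succ, multHarmonic, cbin_succ_eq, cbin_zero]
  | succ n =>
    have h := cbin_succ (n + 1)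
    have hc' := (cbin_pos (n + 1)).ne'
    have hn : (n : ℝ) + 1 ≠ 0 := by positivity
    have hn' : ((n + 1 : ℕ) : ℝ) + 1 ≠ 0 := by positivity
    have hn2 : 2 * ((n + 1 : ℕ) : ℝ) + 1 ≠ 0 := by positivity
    have hc2 : cbin (n + 1 + 1) = (2 * ((n + 1 : ℕ) : ℝ) + 1) * cbin (n + 1)
        / (2 * (((n + 1 : ℕ) : ℝ) + 1)) := by
      field_simp
      linarith
    rw [if_neg n.succ_ne_zero, evenCoeff_succ, evenCoeff_succ, hc2]
    simp only [List.replicate_zero, multHarmonic]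
    push_cast at hn' hn2 ⊢
    field_simp
    ring

/-- The function `∑ 4 ^ n * ζ_{n-1}(2, …, 2) / (binom(2n, n) * n ^ 2) * x ^ (2 n)` is a rational
multiple of the power `θ ^ (2 p + 2)` of the angle `θ = arcsin x`. -/
lemma inIterSpan_even (p : ℕ) : InIterSpan 4 (2 * p + 2) fun t =>
    ps (fun n => (evenCoeff p n : ℂ)) (ratSin t ^ 2) := by
  -- with `V` the function in question, the right-hand side is `dV / dθ = cos θ * dV / dx`
  have hV : ∀ q, ∀ t ∈ Set.Ioo (0 : ℝ) 1,
      HasDerivAt (fun t => ps (fun n => (evenCoeff q n : ℂ)) (ratSin t ^ 2))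
        (angDeriv t * (2 * (ratCos t * (ratSin t *
          ps (fun n => ((n : ℂ) + 1) * (evenCoeff q (n + 1) : ℂ)) (ratSin t ^ 2))))) t :=
    fun q t ht => (hasDerivAt_ps_sq (polyBdd_evenCoeff q) ht).congr_deriv (by push_cast; ring)
  have hV0 : ∀ q, Tendsto (fun t => ps (fun n => (evenCoeff q n : ℂ)) (ratSin t ^ 2))
      (𝓝[>] 0) (𝓝 0) := fun q => by
    simpa [evenCoeff_zero] using tendsto_ps_sq_zero (polyBdd_evenCoeff q)
  have hU0 : ∀ q, Tendsto (fun t => 2 * (ratCos t * (ratSin t *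
      ps (fun n => ((n : ℂ) + 1) * (evenCoeff q (n + 1) : ℂ)) (ratSin t ^ 2))))
      (𝓝[>] 0) (𝓝 0) := fun q => by
    have hcos := (Complex.continuous_ofReal.tendsto 1).comp tendsto_ratCos_zero
    simpa using (hcos.mul (tendsto_ratSin_mul_ps_zero (polyBdd_evenCoeff q).deriv)).const_mul 2
  induction p with
  | zero =>
    obtain ⟨φ, hφ, hφt⟩ := exists_angForm
    have hU : InIterSpan 4 (0 + 1) fun t => Complex.I * (2 * (ratCos t * (ratSin t *
        ps (fun n => ((n : ℂ) + 1) * (evenCoeff 0 (n + 1) : ℂ)) (ratSin t ^ 2)))) := by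
      refine ((HasIterPrimitive.form_mul_const hφ (one_mem_CMZV 4)).ratCast_mul 4).inIterSpan
        (fun t ht => ?_) (by simpa using (hU0 0).const_mul Complex.I)
      refine (((hasDerivAt_ratCos_mul_ratSin_mul_ps (polyBdd_evenCoeff 0) ht).const_mul
        2).const_mul Complex.I).congr_deriv ?_
      have : ps (fun n => (2 * (n : ℂ) + 1) * (((n : ℂ) + 1) * (evenCoeff 0 (n + 1) : ℂ))
          + -2 * ((n : ℂ) * ((n : ℂ) * (evenCoeff 0 n : ℂ)))) (ratSin t ^ 2) = 2 := by
        rw [ps, tsum_eq_single 0]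
        · have h := congrArg (fun x : ℝ => (x : ℂ)) (evenCoeff_rec_zero 0)
          rw [if_pos rfl] at h
          push_cast at h
          push_cast
          linear_combination h
        · intro n hn
          have h := congrArg (fun x : ℝ => (x : ℂ)) (evenCoeff_rec_zero n)
          rw [if_neg hn] at h
          push_cast at h
          have h' : (2 * (n : ℂ) + 1) * (((n : ℂ) + 1) * (evenCoeff 0 (n + 1) : ℂ))
              + -2 * ((n : ℂ) * ((n : ℂ) * (evenCoeff 0 n : ℂ))) = 0 := by
            linear_combination h
          rw [h', zero_mul]
      rw [this, hφt t ht]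
      push_cast
      ring
    have hprim := (HasIterPrimitive.form_mul (unitForms_le_allForms 4 hφ) hU).ratCast_mul (-1)
    refine hprim.inIterSpan (fun t ht => (hV 0 t ht).congr_deriv ?_) (hV0 0)
    rw [hφt t ht]
    push_cast
    linear_combination (angDeriv t * (2 * (ratCos t * (ratSin t *
        ps (fun n => ((n : ℂ) + 1) * (evenCoeff 0 (n + 1) : ℂ)) (ratSin t ^ 2)))) : ℂ)
      * Complex.I_sq
  | succ p ih =>
    refine InIterSpan.of_hasDerivAt_ang_ang (w := 2 * p + 2) (ih.ratCast_mul 4) (hV (p + 1))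
      (fun t ht => ?_) (hV0 (p + 1)) (hU0 (p + 1))
    refine ((hasDerivAt_ratCos_mul_ratSin_mul_ps (polyBdd_evenCoeff (p + 1)) ht).const_mul
      2).congr_deriv ?_
    have : (fun n : ℕ => (2 * (n : ℂ) + 1) * (((n : ℂ) + 1) * (evenCoeff (p + 1) (n + 1) : ℂ))
        + -2 * ((n : ℂ) * ((n : ℂ) * (evenCoeff (p + 1) n : ℂ))))
        = fun n => 2 * (evenCoeff p n : ℂ) := by
      ext n
      have h := congrArg (fun x : ℝ => (x : ℂ)) (evenCoeff_rec p n)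
      push_cast at h
      linear_combination h
    rw [this, ps_const_mul]
    push_cast
    ring

lemma polyBdd_evenCoeff_div (p m : ℕ) : PolyBdd fun n => (evenCoeff p n : ℂ) / (n : ℂ) ^ m := by
  refine (polyBdd_evenCoeff p).mono fun n => ?_
  cases n with
  | zero => simp [evenCoeff_zero]
  | succ n =>
    rw [norm_div, norm_pow, Complex.norm_natCast]
    refine div_le_self (norm_nonneg _) (one_le_pow₀ ?_)
    push_cast
    linarith [(Nat.cast_nonneg n : (0 : ℝ) ≤ n)]

lemma inIterSpan_even_pow (p m : ℕ) : InIterSpan 4 (2 * p + 2 + m) fun t =>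
    ps (fun n => (evenCoeff p n : ℂ) / (n : ℂ) ^ m) (ratSin t ^ 2) := by
  induction m with
  | zero => simpa using inIterSpan_even p
  | succ m ih =>
    obtain ⟨φ, hφ, hφt⟩ := exists_logForm
    have hb := polyBdd_evenCoeff_div p (m + 1)
    refine ((HasIterPrimitive.form_mul hφ ih).ratCast_mul 2).inIterSpan (fun t ht => ?_)
      (by simpa [evenCoeff_zero] using tendsto_ps_sq_zero hb)
    refine (hasDerivAt_ps_sq_log hb ht).congr_deriv ?_
    have hcoef : (fun n : ℕ => (n : ℂ) * ((evenCoeff p n : ℂ) / (n : ℂ) ^ (m + 1)))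
        = fun n : ℕ => (evenCoeff p n : ℂ) / (n : ℂ) ^ m := by
      ext n
      cases n with
      | zero => simp [evenCoeff_zero]
      | succ n =>
        have : ((n + 1 : ℕ) : ℂ) ≠ 0 := by exact_mod_cast n.succ_ne_zero
        rw [pow_succ]
        field_simp
    rw [ps_const_mul, hcoef, hφt t ht]
    push_cast
    ring

/-! ### Convergence -/

/-- Powers of harmonic numbers are negligible against `(n + 1) ^ (1 / 4)`. -/
lemma summable_realHarmonic_pow (R : ℕ) :
    Summable fun n : ℕ => realHarmonic (n + 1) ^ R * (1 / (√((n : ℝ) + 1) * ((n : ℝ) + 1))) := by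
  set ε : ℝ := 1 / (4 * (R + 1)) with hε
  have hε0 : 0 < ε := by positivity
  have hsum : Summable fun n : ℕ => ((n : ℝ) + 1) ^ (-(5 / 4) : ℝ) := by
    have := (summable_nat_add_iff 1).mpr (Real.summable_nat_rpow.mpr
      (show (-(5 / 4) : ℝ) < -1 by norm_num))
    simpa using this
  refine Summable.of_nonneg_of_le (fun n => ?_) (fun n => ?_) (hsum.mul_left ((1 + 1 / ε) ^ R))
  · have := realHarmonic_nonneg (n + 1)
    positivity
  · set x : ℝ := (n : ℝ) + 1 with hx
    have hx1 : 1 ≤ x := by linarith [(Nat.cast_nonneg n : (0 : ℝ) ≤ n)]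
    have hx0 : 0 < x := by linarith
    have h1 : realHarmonic (n + 1) ≤ (1 + 1 / ε) * x ^ ε := by
      have h2 := realHarmonic_le_log (n + 1)
      have h3 := Real.log_le_rpow_div hx0.le hε0
      have h4 : 1 ≤ x ^ ε := Real.one_le_rpow hx1 hε0.le
      push_cast at h2
      rw [← hx] at h2
      calc realHarmonic (n + 1) ≤ 1 + x ^ ε / ε := h2.trans (by linarith)
        _ ≤ x ^ ε + x ^ ε / ε := by linarith
        _ = _ := by ring
    have h5 : realHarmonic (n + 1) ^ R ≤ (1 + 1 / ε) ^ R * x ^ (1 / 4 : ℝ) := by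
      refine (pow_le_pow_left₀ (realHarmonic_nonneg _) h1 R).trans ?_
      rw [mul_pow, ← Real.rpow_mul_natCast hx0.le]
      refine mul_le_mul_of_nonneg_left (Real.rpow_le_rpow_of_exponent_le hx1 ?_) (by positivity)
      rw [hε, div_mul_eq_mul_div, div_le_div_iff₀ (by positivity) (by norm_num)]
      linarith
    have h6 : 1 / (√x * x) = x ^ (-(3 / 2) : ℝ) := by
      rw [Real.rpow_neg hx0.le, one_div, Real.sqrt_eq_rpow]
      congr 1
      nth_rewrite 2 [← Real.rpow_one x]
      rw [← Real.rpow_add hx0]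
      norm_num
    rw [h6]
    calc _ ≤ (1 + 1 / ε) ^ R * x ^ (1 / 4 : ℝ) * x ^ (-(3 / 2) : ℝ) := by gcongr
      _ = _ := by
        rw [mul_assoc, ← Real.rpow_add hx0]
        norm_num

lemma oddCoeff_div_bounds (p m n : ℕ) (hm : 1 ≤ m) :
    0 ≤ oddCoeff p n / (2 * (n : ℝ) + 1) ^ m ∧
      oddCoeff p n / (2 * (n : ℝ) + 1) ^ m
        ≤ realHarmonic (n + 1) ^ p * (1 / (√((n : ℝ) + 1) * ((n : ℝ) + 1))) := by
  obtain ⟨h0, h1⟩ := multTHarmonic_bounds (fun a => one_le_of_mem_replicate_two (p := p)) n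
  rw [List.length_replicate] at h1
  have hc := cbin_pos n
  have hn : (0 : ℝ) ≤ n := Nat.cast_nonneg n
  have hc1 : cbin n ≤ 1 / √((n : ℝ) + 1) := by
    rw [le_div_iff₀ (by positivity)]
    refine le_of_sq_le_sq ?_ zero_le_one
    rw [mul_pow, Real.sq_sqrt (by positivity), one_pow]
    refine le_trans ?_ (cbin_sq_le n)
    gcongr
    linarith
  have hτ : multTHarmonic (List.replicate p 2) n ≤ realHarmonic (n + 1) ^ p :=
    h1.trans (pow_le_pow_left₀ (realHarmonic_nonneg _) (realHarmonic_mono n.le_succ) _)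
  refine ⟨by unfold oddCoeff; positivity, ?_⟩
  rw [oddCoeff, div_eq_mul_one_div]
  calc cbin n * multTHarmonic (List.replicate p 2) n * (1 / (2 * (n : ℝ) + 1) ^ m)
      ≤ 1 / √((n : ℝ) + 1) * realHarmonic (n + 1) ^ p * (1 / ((n : ℝ) + 1)) :=
        mul_le_mul (mul_le_mul hc1 hτ h0 (by positivity)) (one_div_odd_pow_le hm n).2
          (by positivity) (mul_nonneg (by positivity) (pow_nonneg (realHarmonic_nonneg _) _))
    _ = _ := by
        field_simp

lemma evenCoeff_div_bounds (p m n : ℕ) :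
    0 ≤ evenCoeff p (n + 1) / ((n : ℝ) + 1) ^ m ∧
      evenCoeff p (n + 1) / ((n : ℝ) + 1) ^ m
        ≤ 2 * (realHarmonic (n + 1) ^ p * (1 / (√((n : ℝ) + 1) * ((n : ℝ) + 1)))) := by
  obtain ⟨h0, h1⟩ := multHarmonic_bounds (fun a => one_le_of_mem_replicate_two (p := p)) n
  rw [List.length_replicate] at h1
  have hc := cbin_pos (n + 1)
  have hn : (0 : ℝ) ≤ n := Nat.cast_nonneg n
  have hζ : multHarmonic (List.replicate p 2) n ≤ realHarmonic (n + 1) ^ p :=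
    h1.trans (pow_le_pow_left₀ (realHarmonic_nonneg _) (realHarmonic_mono n.le_succ) _)
  rw [evenCoeff_succ]
  refine ⟨by positivity, (div_le_self (by positivity) (one_le_pow₀ (by linarith))).trans ?_⟩
  have hs : √((n : ℝ) + 1) ^ 2 = (n : ℝ) + 1 := Real.sq_sqrt (by positivity)
  have hs0 : 0 < √((n : ℝ) + 1) := Real.sqrt_pos.mpr (by positivity)
  calc multHarmonic (List.replicate p 2) n / (cbin (n + 1) * ((n : ℝ) + 1) ^ 2)
      = multHarmonic (List.replicate p 2) n * (1 / cbin (n + 1)) / ((n : ℝ) + 1) ^ 2 := by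
        field_simp
    _ ≤ realHarmonic (n + 1) ^ p * (2 * √((n : ℝ) + 1)) / ((n : ℝ) + 1) ^ 2 := by
        have := one_div_cbin_le n
        have := realHarmonic_nonneg (n + 1)
        gcongr
    _ = _ := by
        field_simp
        rw [hs]

/-- Comparison with the convergent series of `summable_realHarmonic_pow`. -/
lemma summable_mul_star {k : List ℕ} (hk : ∀ a ∈ k, 1 ≤ a) {f : ℕ → ℝ} {s p : ℕ} (hs : s ≤ 1)
    (hf0 : ∀ n, 0 ≤ f n)
    (hf : ∀ n, f n ≤ 2 * (realHarmonic (n + 1) ^ p * (1 / (√((n : ℝ) + 1) * ((n : ℝ) + 1))))) :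
    Summable fun n => f n * multTHarmonicStar k (n + s) := by
  refine Summable.of_nonneg_of_le (fun n => mul_nonneg (hf0 n) (multTHarmonicStar_nonneg _ _))
    (fun n => ?_) ((summable_realHarmonic_pow (p + k.length)).mul_left 2)
  have h1 : multTHarmonicStar k (n + s) ≤ realHarmonic (n + 1) ^ k.length :=
    (multTHarmonicStar_le hk _).trans (pow_le_pow_left₀ (realHarmonic_nonneg _)
      (realHarmonic_mono (by omega)) _)
  calc f n * multTHarmonicStar k (n + s)
      ≤ 2 * (realHarmonic (n + 1) ^ p * (1 / (√((n : ℝ) + 1) * ((n : ℝ) + 1))))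
        * realHarmonic (n + 1) ^ k.length := by
        have := (hf0 n).trans (hf n)
        exact mul_le_mul (hf n) h1 (multTHarmonicStar_nonneg _ _) this
    _ = _ := by rw [pow_add]; ring

/-! ### The two series -/

lemma odd_series_mem (m p : ℕ) (hm : 1 ≤ m) (k : List ℕ) (hk : ∀ a ∈ k, 1 ≤ a) :
    ∃ c ∈ CMZV 4 (2 * p + m + k.sum), HasSum (fun n : ℕ =>
      ((oddCoeff p n / (2 * (n : ℝ) + 1) ^ m * multTHarmonicStar k n : ℝ) : ℂ))
      (Complex.I * c) := by
  set f : ℕ → ℝ := fun n => oddCoeff p n / (2 * (n : ℝ) + 1) ^ m with hf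
  have hb : ∀ n, 0 ≤ f n ∧ f n
      ≤ 2 * (realHarmonic (n + 1) ^ p * (1 / (√((n : ℝ) + 1) * ((n : ℝ) + 1)))) := fun n => by
    obtain ⟨h1, h2⟩ := oddCoeff_div_bounds p m n hm
    exact ⟨h1, by linarith⟩
  have hsk := summable_mul_star hk (Nat.zero_le 1) (fun n => (hb n).1) fun n => (hb n).2
  have hs1 := summable_mul_star (k := []) (by simp) (Nat.zero_le 1) (fun n => (hb n).1)
    fun n => (hb n).2
  simp only [multTHarmonicStar, mul_one, add_zero] at hs1 hsk
  set e : ℕ → ℂ := fun n => Complex.I * (f n : ℂ) with he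
  have hnorm : ∀ n, ‖e n‖ = f n := fun n => by
    rw [he]
    simp [abs_of_nonneg (hb n).1]
  have hrep : IsRepresented (2 * p + m) e := by
    obtain ⟨m, rfl⟩ : ∃ m', m = m' + 1 := ⟨m - 1, by omega⟩
    refine ⟨_, inIterSpan_odd_pow p m, Or.inr (Or.inl fun t _ => ?_)⟩
    rw [he, ps_const_mul, hf]
    push_cast
    ring
  have key := IsRepresented.tsum_mul_star_mem k hk _ e hrep (hs1.congr fun n => (hnorm n).symm)
    (hsk.congr fun n => by rw [hnorm])
  have hsum : HasSum (fun n => ((f n * multTHarmonicStar k n : ℝ) : ℂ))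
      (∑' n, ((f n * multTHarmonicStar k n : ℝ) : ℂ)) := by
    refine Summable.hasSum ?_
    exact_mod_cast hsk
  have hval : ∑' n, e n * (multTHarmonicStar k n : ℂ)
      = Complex.I * ∑' n, ((f n * multTHarmonicStar k n : ℝ) : ℂ) := by
    rw [← tsum_mul_left]
    refine tsum_congr fun n => ?_
    rw [he]
    push_cast
    ring
  refine ⟨-(∑' n, e n * (multTHarmonicStar k n : ℂ)), neg_mem key, ?_⟩
  convert hsum using 1
  rw [hval]
  linear_combination (-∑' n, ((f n * multTHarmonicStar k n : ℝ) : ℂ)) * Complex.I_sq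

lemma even_series_mem (m p : ℕ) (k : List ℕ) (hk : ∀ a ∈ k, 1 ≤ a) :
    ∃ c ∈ CMZV 4 (2 * p + 2 + m + k.sum), HasSum (fun n : ℕ =>
      ((evenCoeff p (n + 1) / ((n : ℝ) + 1) ^ m * multTHarmonicStar k (n + 1) : ℝ) : ℂ)) c := by
  set f : ℕ → ℝ := fun n => evenCoeff p (n + 1) / ((n : ℝ) + 1) ^ m with hf
  have hb := evenCoeff_div_bounds p m
  have hsk := summable_mul_star hk le_rfl (fun n => (hb n).1) fun n => (hb n).2
  have hs1 := summable_mul_star (k := []) (by simp) le_rfl (fun n => (hb n).1)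
    fun n => (hb n).2
  simp only [multTHarmonicStar, mul_one] at hs1
  set e : ℕ → ℂ := fun n => (evenCoeff p n : ℂ) / (n : ℂ) ^ m with he
  have he0 : e 0 = 0 := by simp [he, evenCoeff_zero]
  have hes : ∀ n, e (n + 1) = (f n : ℂ) := fun n => by
    rw [he, hf]
    push_cast
    rfl
  have hnorm : ∀ n, ‖e (n + 1)‖ = f n := fun n => by
    rw [hes, Complex.norm_real, Real.norm_eq_abs, abs_of_nonneg (hb n).1]
  have hrep : IsRepresented (2 * p + 2 + m) e :=
    ⟨_, inIterSpan_even_pow p m, Or.inl fun t _ => rfl⟩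
  have hsek : Summable fun n => ‖e n‖ * multTHarmonicStar k n :=
    (summable_nat_add_iff 1).mp (hsk.congr fun n => by rw [hnorm])
  have key := IsRepresented.tsum_mul_star_mem k hk _ e hrep
    ((summable_nat_add_iff 1).mp (hs1.congr fun n => (hnorm n).symm)) hsek
  refine ⟨_, key, ?_⟩
  have hs : Summable fun n => e n * (multTHarmonicStar k n : ℂ) := by
    refine Summable.of_norm (hsek.congr fun n => ?_)
    rw [norm_mul, Complex.norm_real, Real.norm_eq_abs, abs_of_nonneg (multTHarmonicStar_nonneg _ _)]
  have h := (hasSum_nat_add_iff' 1).mpr hs.hasSum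
  rw [Finset.sum_range_one, he0, zero_mul, sub_zero] at h
  have hterm : (fun n => ((f n * multTHarmonicStar k (n + 1) : ℝ) : ℂ))
      = fun n => e (n + 1) * (multTHarmonicStar k (n + 1) : ℂ) := by
    ext n
    rw [hes]
    push_cast
    rfl
  rw [hterm]
  exact h

theorem mainTheorem4 (m p : ℕ) (hm : 1 ≤ m) (hp : 1 ≤ p)
    (k : List ℕ) (hk : ∀ a ∈ k, 1 ≤ a) :
    (∃ c ∈ CMZV 4 (2 * p + m + k.sum - 2),
      HasSum (fun n : ℕ =>
        (((Nat.choose (2 * n) n : ℝ) / 4 ^ n *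
          (multTHarmonic (List.replicate (p - 1) 2) n * multTHarmonicStar k n /
            (2 * (n : ℝ) + 1) ^ m) : ℝ) : ℂ))
        (Complex.I * c)) ∧
    (∃ c ∈ CMZV 4 (2 * p + m + k.sum - 1),
      -- the summation index of the series is `n + 1`, with `n ≥ 0`
      HasSum (fun n : ℕ =>
        (((4 : ℝ) ^ (n + 1) *
            multHarmonic (List.replicate (p - 1) 2) n * multTHarmonicStar k (n + 1) /
          ((Nat.choose (2 * (n + 1)) (n + 1) : ℝ) * ((n : ℝ) + 1) ^ (m + 1)) : ℝ) : ℂ))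
        c) := by
  obtain ⟨p, rfl⟩ : ∃ p', p = p' + 1 := ⟨p - 1, by omega⟩
  rw [Nat.add_sub_cancel]
  constructor
  · obtain ⟨c, hc, h⟩ := odd_series_mem m p hm k hk
    refine ⟨c, ?_, ?_⟩
    · convert! hc using 2
      omega
    · convert! h using 3 with n
      rw [oddCoeff, cbin, Nat.centralBinom_eq_two_mul_choose]
      ring
  · obtain ⟨m, rfl⟩ : ∃ m', m = m' + 1 := ⟨m - 1, by omega⟩
    obtain ⟨c, hc, h⟩ := even_series_mem m p k hk
    refine ⟨c, ?_, ?_⟩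
    · convert! hc using 2
      omega
    · convert! h using 3 with n
      have hch : (Nat.choose (2 * (n + 1)) (n + 1) : ℝ) ≠ 0 := by
        rw [← Nat.centralBinom_eq_two_mul_choose]
        exact_mod_cast (Nat.centralBinom_pos (n + 1)).ne'
      rw [evenCoeff_succ, cbin, Nat.centralBinom_eq_two_mul_choose]
      field_simp
      ring
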